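/- Let $k,m\in\mathbb Z$ and let $n\ge 1$ be an integer. Write $\mathbb H$ for the upper half plane, $\tau\in\mathbb H$, $z\in\mathbb C$, $v=\operatorname{Im}\tau$, $y=\operatorname{Im}z$. For $M=\begin{pmatrix}a&b\\c&d\end{pmatrix}$ with real entries and determinant $\ell>0$, and $X,Y\in\mathbb R$, and for $f:\mathbb H\times\mathbb C\to\mathbb C$, put $f|_{k,m}[M,(X,Y)]:=f|_{k,m}[\ell^{-1/2}M,(X,Y)]$ where, if $\ell=1$, $$(f|_{k,m}[M,(X,Y)])(\tau,z)=(c\tau+d)^{-k}\,e^{2\pi i m\left(-\frac{c(z+X\tau+Y)^2}{c\tau+d}+X^2\tau+2Xz+XY\right)}\,f\!\left(\frac{a\tau+b}{c\tau+d},\frac{z+X\tau+Y}{c\tau+d}\right).$$ Let $\Gamma(1)^J=\{[M,(\lambda,\mu)] : M\in SL_2(\mathbb Z),\ \lambda,\mu\in\mathbb Z\}$ and $T=\left[\begin{pmatrix}0&-1\\1&0\end{pmatrix},(1,0)\right]$. Let $\mathcal P_m$ be the set of holomorphic $g:\mathbb H\times\mathbb C\to\mathbb C$ for which there are $K,\rho,\sigma>0$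 with $|g(\tau,z)|<K(|\tau|^\rho+v^{-\sigma})e^{2\pi m y^2/v}$ for all $(\tau,z)$. Let $J^{\int}_{k,m}$ be the set of real analytic $f:\mathbb H\times\mathbb C\to\mathbb C$ with $f(\tau+1,z)=f(\tau,z+1)=f(\tau,z)$, with $f|_{k,m}\gamma-f\in\mathcal P_m$ for all $\gamma\in\Gamma(1)^J$, and with $|f(\tau,z)|\,v^{-k/2}e^{-2\pi m y^2/v}\to0$ as $v,y\to\infty$ (uniformly in $\operatorname{Re}\tau$ and $\operatorname{Re}z$). For $f\in J^{\int}_{k,m}$ define $$(f|_{k,m}\mathcal V_n^\infty)(\tau,z)=n^{k-1}\sum_{\substack{ad=n,\ a>0\\ b \bmod d}}d^{-k}f\!\left(\frac{a\tau+b}{d},az\right).$$ 1. If $f\in J^{\int}_{k,m}$, then $f|_{k,m}\mathcal V_n^\infty\in J^{\int}_{k,mn}$. 2. Let $f\in J^{\int}_{k,m}$ satisfy $f|_{k,m}[-I,(0,0)]=f$, that is, $f(\tau,-z)=(-1)^kf(\tau,z)$. Define $P_T$ and $\hat P_T$ by $f|_{k,m}T=f+P_T$ and $(f|_{k,m}\mathcal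 V_n^\infty)|_{k,mn}T=f|_{k,m}\mathcal V_n^\infty+\hat P_T$, and put $P_T^{(n)}(\tau,z)=P_T(\tau,\sqrt n\,z)$. Then $$\hat P_T=n^{\frac k2-1}\,P_T^{(n)}\big|_{k,mn}\tilde{\mathcal V}_n ,$$ where $\tilde{\mathcal V}_n$ is the following formal sum, acting linearly term by term and running over integers $a,b,c,d$: $$\begin{aligned}\tilde{\mathcal V}_n={}&\sum_{\substack{ad-bc=n\\ a>c>0,\ d>-b>0}}\left\{\left[\begin{pmatrix}a&b\\c&d\end{pmatrix},(0,0)\right]+\left[\begin{pmatrix}a&-b\\-c&d\end{pmatrix},(0,0)\right]\right\}\\&+\sum_{\substack{ad=n\\ -\frac d2<b\le\frac d2}}\left[\begin{pmatrix}a&b\\0&d\end{pmatrix},(0,0)\right]+\sum_{\substack{ad=n\\ -\frac a2<c\le\frac a2,\ c\ne0}}\left[\begin{pmatrix}a&0\\c&d\end{pmatrix},(0,0)\right].\end{aligned}$$ -/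

import Mathlib

open UpperHalfPlane Filter Topology
open scoped MatrixGroups

namespace JacobiHecke

/-- The slash action `f|_{k,m}[M,(X,Y),1]` of an element of the real Jacobi group with
`M ∈ SL₂(ℝ)` and `(X,Y) ∈ ℝ²`. -/
noncomputable def slash (k m : ℤ) (f : ℍ → ℂ → ℂ) (M : SL(2, ℝ)) (X Y : ℝ) : ℍ → ℂ → ℂ :=
  fun τ z =>
    ((M 1 0 : ℂ) * τ + M 1 1) ^ (-k) *
      Complex.exp (2 * Real.pi * Complex.I * m *
        (-((M 1 0 : ℂ) * (z + X * τ + Y) ^ 2 / ((M 1 0 : ℂ) * τ + M 1 1)) +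
          X ^ 2 * τ + 2 * X * z + X * Y)) *
      f (M • τ) ((z + X * τ + Y) / ((M 1 0 : ℂ) * τ + M 1 1))

/-- The slash action of `[M,(lam,mu)] ∈ Γ(1)^J = SL₂(ℤ) ⋉ ℤ²`. -/
noncomputable def slashInt (k m : ℤ) (f : ℍ → ℂ → ℂ) (M : SL(2, ℤ)) (lam mu : ℤ) :
    ℍ → ℂ → ℂ :=
  slash k m f (Matrix.SpecialLinearGroup.map (Int.castRingHom ℝ) M) lam mu

/-- `f|_{k,m}T` for `T = [(0, -1; 1, 0), (1, 0)]`. -/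
noncomputable def slashT (k m : ℤ) (f : ℍ → ℂ → ℂ) : ℍ → ℂ → ℂ :=
  slashInt k m f ModularGroup.S 1 0

theorem det_normalize {A : Matrix (Fin 2) (Fin 2) ℝ} (h : 0 < A.det) :
    ((Real.sqrt A.det)⁻¹ • A).det = 1 := by
  rw [Matrix.det_smul, Fintype.card_fin, inv_pow, Real.sq_sqrt h.le, inv_mul_cancel₀ h.ne']

/-- The matrix `(det A)^{-1/2} A ∈ SL₂(ℝ)`, for `det A > 0`. -/
noncomputable def normalize (A : Matrix (Fin 2) (Fin 2) ℝ) (h : 0 < A.det) : SL(2, ℝ) :=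
  ⟨(Real.sqrt A.det)⁻¹ • A, det_normalize h⟩

open Classical in
/-- `f|_{k,m}[A,(X,Y)] := f|_{k,m}[(det A)^{-1/2} A,(X,Y),1]` for a real matrix `A` of positive
determinant (only such `A` occur below; the value `0` otherwise is a dummy). -/
noncomputable def slashPos (k m : ℤ) (f : ℍ → ℂ → ℂ) (A : Matrix (Fin 2) (Fin 2) ℝ)
    (X Y : ℝ) : ℍ → ℂ → ℂ :=
  if h : 0 < A.det then slash k m f (normalize A h) X Y else 0

/-- The functions `g` on `ℍ × ℂ` that are holomorphic and satisfy
`|g(τ,z)| < K (|τ|^ρ + v^{-σ}) e^{2πm y²/v}` for some `K, ρ, σ > 0`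
(`v = Im τ`, `y = Im z`). -/
structure IsPeriodClass (m : ℤ) (g : ℍ → ℂ → ℂ) : Prop where
  holo : DifferentiableOn ℂ (fun p : ℂ × ℂ => g (ofComplex p.1) p.2) {p | 0 < p.1.im}
  bound : ∃ K ρ σ : ℝ, 0 < K ∧ 0 < ρ ∧ 0 < σ ∧ ∀ (τ : ℍ) (z : ℂ),
    ‖g τ z‖ < K * (‖(τ : ℂ)‖ ^ ρ + τ.im ^ (-σ)) *
      Real.exp (2 * Real.pi * m * (z.im ^ 2 / τ.im))

/-- The Jacobi integrals of weight `k` and index `m` on `Γ(1)^J`. -/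
structure IsJacobiIntegral (k m : ℤ) (f : ℍ → ℂ → ℂ) : Prop where
  analytic : AnalyticOnNhd ℝ (fun p : ℂ × ℂ => f (ofComplex p.1) p.2) {p | 0 < p.1.im}
  periodic_tau : ∀ (τ : ℍ) (z : ℂ), f ((1 : ℝ) +ᵥ τ) z = f τ z
  periodic_z : ∀ (τ : ℍ) (z : ℂ), f τ (z + 1) = f τ z
  period : ∀ (γ : SL(2, ℤ)) (lam mu : ℤ), IsPeriodClass m (slashInt k m f γ lam mu - f)
  growth : Tendsto
    (fun p : ℍ × ℂ => ‖f p.1 p.2‖ * p.1.im ^ (-(k : ℝ) / 2) *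
      Real.exp (-(2 * Real.pi * m * (p.2.im ^ 2 / p.1.im))))
    (comap (fun p : ℍ × ℂ => (p.1.im, p.2.im)) (atTop ×ˢ atTop)) (𝓝 0)

/-- The operator `V_n^∞`:
`n^{k-1} ∑_{ad=n, a>0, b mod d} d^{-k} f((aτ+b)/d, az)`. Here `ofComplex` only views
`(aτ+b)/d`, whose imaginary part is positive, as a point of `ℍ`. -/
noncomputable def heckeV (k : ℤ) (n : ℕ) (f : ℍ → ℂ → ℂ) : ℍ → ℂ → ℂ :=
  fun τ z => (n : ℂ) ^ (k - 1) *
    ∑ q ∈ n.divisorsAntidiagonal, ∑ b ∈ Finset.range q.2,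
      (q.2 : ℂ) ^ (-k) * f (ofComplex (((q.1 : ℂ) * τ + b) / q.2)) ((q.1 : ℂ) * z)

/-- The scaling `[n^{-1/2} I, (0,0)]`, that is `g(τ,z) ↦ g(τ, √n z)`. -/
noncomputable def scale (n : ℕ) (g : ℍ → ℂ → ℂ) : ℍ → ℂ → ℂ :=
  fun τ z => g τ ((Real.sqrt n : ℂ) * z)

/-- A finite box of integer quadruples `(a,b,c,d)`. It contains every quadruple
occurring in the index sets below, see the membership lemmas. -/
noncomputable def box (n : ℕ) : Finset (ℤ × ℤ × ℤ × ℤ) :=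
  Finset.Icc (-(n : ℤ)) n ×ˢ Finset.Icc (-(n : ℤ)) n ×ˢ
    Finset.Icc (-(n : ℤ)) n ×ˢ Finset.Icc (-(n : ℤ)) n

/-- `ad - bc = n`, `a > c > 0`, `d > -b > 0`. -/
noncomputable def interiorSet (n : ℕ) : Finset (ℤ × ℤ × ℤ × ℤ) :=
  (box n).filter fun (a, b, c, d) => a * d - b * c = n ∧ c < a ∧ 0 < c ∧ -b < d ∧ 0 < -b

/-- `ad = n`, `-d/2 < b ≤ d/2`, `c = 0`. -/
noncomputable def upperSet (n : ℕ) : Finset (ℤ × ℤ × ℤ × ℤ) :=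
  (box n).filter fun (a, b, c, d) => a * d = n ∧ -d < 2 * b ∧ 2 * b ≤ d ∧ c = 0

/-- `ad = n`, `-a/2 < c ≤ a/2`, `c ≠ 0`, `b = 0`. -/
noncomputable def lowerSet (n : ℕ) : Finset (ℤ × ℤ × ℤ × ℤ) :=
  (box n).filter fun (a, b, c, d) => a * d = n ∧ -a < 2 * c ∧ 2 * c ≤ a ∧ c ≠ 0 ∧ b = 0

theorem mem_interiorSet {n : ℕ} {a b c d : ℤ} :
    (a, b, c, d) ∈ interiorSet n ↔
      a * d - b * c = n ∧ c < a ∧ 0 < c ∧ -b < d ∧ 0 < -b := by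
  simp only [interiorSet, box, Finset.mem_filter, Finset.mem_product, Finset.mem_Icc]
  refine ⟨fun h => h.2, fun h => ⟨?_, h⟩⟩
  obtain ⟨h, h1, h2, h3, h4⟩ := h
  have e1 : a ≤ n := by nlinarith
  have e2 : d ≤ n := by nlinarith
  refine ⟨⟨?_, ?_⟩, ⟨?_, ?_⟩, ⟨?_, ?_⟩, ?_, ?_⟩ <;> linarith

theorem mem_upperSet {n : ℕ} (hn : 0 < n) {a b c d : ℤ} :
    (a, b, c, d) ∈ upperSet n ↔ a * d = n ∧ -d < 2 * b ∧ 2 * b ≤ d ∧ c = 0 := by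
  simp only [upperSet, box, Finset.mem_filter, Finset.mem_product, Finset.mem_Icc]
  refine ⟨fun h => h.2, fun h => ⟨?_, h⟩⟩
  obtain ⟨h, h1, h2, h3⟩ := h
  have hn' : (0 : ℤ) < n := by exact_mod_cast hn
  have hd : 0 < d := by linarith
  have ha : 0 < a := by
    by_contra h0
    nlinarith
  have e1 : a ≤ n := by nlinarith
  have e2 : d ≤ n := by nlinarith
  refine ⟨⟨?_, ?_⟩, ⟨?_, ?_⟩, ⟨?_, ?_⟩, ?_, ?_⟩ <;> linarith

theorem mem_lowerSet {n : ℕ} (hn : 0 < n) {a b c d : ℤ} :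
    (a, b, c, d) ∈ lowerSet n ↔
      a * d = n ∧ -a < 2 * c ∧ 2 * c ≤ a ∧ c ≠ 0 ∧ b = 0 := by
  simp only [lowerSet, box, Finset.mem_filter, Finset.mem_product, Finset.mem_Icc]
  refine ⟨fun h => h.2, fun h => ⟨?_, h⟩⟩
  obtain ⟨h, h1, h2, h3, h4⟩ := h
  have hn' : (0 : ℤ) < n := by exact_mod_cast hn
  have ha : 0 < a := by linarith
  have hd : 0 < d := by
    by_contra h0
    nlinarith
  have e1 : a ≤ n := by nlinarith
  have e2 : d ≤ n := by nlinarith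
  refine ⟨⟨?_, ?_⟩, ⟨?_, ?_⟩, ⟨?_, ?_⟩, ?_, ?_⟩ <;> linarith

/-- `g|_{k,m}[(a, b; c, d), (0,0)]` for integers with `ad - bc > 0`. -/
noncomputable def slashMat (k m : ℤ) (g : ℍ → ℂ → ℂ) (a b c d : ℤ) : ℍ → ℂ → ℂ :=
  slashPos k m g !![(a : ℝ), b; c, d] 0 0

/-- `g|_{k,m} 𝒱̃_n`, the action of the formal sum `𝒱̃_n` extended linearly. -/
noncomputable def slashVtilde (k m : ℤ) (n : ℕ) (g : ℍ → ℂ → ℂ) : ℍ → ℂ → ℂ :=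
  ∑ q ∈ interiorSet n,
      (slashMat k m g q.1 q.2.1 q.2.2.1 q.2.2.2 +
        slashMat k m g q.1 (-q.2.1) (-q.2.2.1) q.2.2.2) +
    ∑ q ∈ upperSet n, slashMat k m g q.1 q.2.1 q.2.2.1 q.2.2.2 +
    ∑ q ∈ lowerSet n, slashMat k m g q.1 q.2.1 q.2.2.1 q.2.2.2

end JacobiHecke

/-!
For an integral matrix `A = (a, b; c, d)` of determinant `n` put `(f‖A)(τ,z) = n^{k-1} (cτ+d)^{-k}
e^{-2πi mn c z²/(cτ+d)} f(Aτ, nz/(cτ+d))` (`heckeSlash`). This operation intertwines the actions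
of the Jacobi group in index `m` and in index `mn` (`slashInt_heckeSlash`), and `V_n^∞ f` is the
sum of `f‖A` over the matrices `A = (a, b; 0, d)` with `ad = n` and `0 ≤ b < d`, which represent
the classes `SL₂(ℤ) A` of integral matrices of determinant `n`.

Right multiplication by `γ ∈ SL₂(ℤ)` permutes these classes (`exists_hermite_perm`). Hence a
period of `V_n^∞ f` is a sum of functions `g‖A`, where `g` is a period of `f` and `A` is upper
triangular (`slashInt_heckeV_sub`), and the class of admissible periods is stable under sums and
under such `A` (`IsPeriodClass.heckeSlash`). Analyticity, periodicity and growth are checked for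
each summand, so `V_n^∞ f` is a Jacobi integral of index `mn`.

For the period at `T`, periodicity in `z` gives `f|T = f|S` with `S = (0, -1; 1, 0)`
(`slashT_eq_slashInt_S`). Therefore `P_T‖A = f‖(S A) - f‖A`, and `(f‖A)|T = f‖(A S)` for upper
triangular `A`. As `f‖A` depends only on `A` up to sign and up to adding multiples of the second
row to the first, the formula for the period amounts to the congruence `T^∞ (S - 1) ≡ (S - 1)
𝒱̃_n` of formal sums, with `T^∞` the sum of the matrices defining `V_n^∞`
(`sum_hermite_mul_S_sub`). After the obvious cancellations it says that two families of classes of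
matrices `(p, -q; r, s)` with `r, s > 0` agree, together with the mirror image of this fact under
conjugation by `diag(1, -1)`. One family consists of matrices with `0 ≤ q < s`, the other of
matrices with `0 ≤ p < r`; each class has one member of either kind, and division of `p` by `r`
leads from the first to the second (`sum_euclidLeft_eq_sum_euclidRight`).
-/

namespace JacobiHecke

/-! ### The slash operator attached to an integral matrix -/

/-- The function `f‖A`, for an integral matrix `A` of determinant `n`: `n^{k-1} (cτ+d)^{-k}
e^{-2πi mn c z²/(cτ+d)} f(Aτ, nz/(cτ+d))`. Up to a power of `n` it is `f(τ, √n z)` slashed by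
`n^{-1/2} A` in weight `k` and index `mn`, with the square roots of `n` cancelled. The point `Aτ`
is formed with `ofComplex`, which is meaningful because `det A > 0` makes its imaginary part
positive. -/
noncomputable def heckeSlash (k m : ℤ) (n : ℕ) (f : ℍ → ℂ → ℂ) (A : Matrix (Fin 2) (Fin 2) ℤ) :
    ℍ → ℂ → ℂ :=
  fun τ z => (n : ℂ) ^ (k - 1) * ((A 1 0 : ℂ) * τ + A 1 1) ^ (-k) *
    Complex.exp (2 * Real.pi * Complex.I * m *
      (-(n * (A 1 0 : ℂ) * z ^ 2 / ((A 1 0 : ℂ) * τ + A 1 1)))) *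
    f (ofComplex (((A 0 0 : ℂ) * τ + A 0 1) / ((A 1 0 : ℂ) * τ + A 1 1)))
      (n * z / ((A 1 0 : ℂ) * τ + A 1 1))

theorem denom_ne_zero_of_det_pos {a b c d : ℝ} (h : 0 < a * d - b * c) (τ : ℍ) :
    (c : ℂ) * τ + d ≠ 0 := by
  have h0 : ![c, d] ≠ 0 := by
    intro h0
    have h1 : c = 0 := by simpa using congrFun h0 0
    have h2 : d = 0 := by simpa using congrFun h0 1
    simp [h1, h2] at h
  simpa using UpperHalfPlane.linear_ne_zero τ h0

theorem im_moebius_pos {a b c d : ℝ} (h : 0 < a * d - b * c) (τ : ℍ) :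
    0 < (((a : ℂ) * τ + b) / ((c : ℂ) * τ + d)).im := by
  have h1 : (((a : ℂ) * τ + b) / ((c : ℂ) * τ + d)).im =
      (a * d - b * c) * τ.im / Complex.normSq ((c : ℂ) * τ + d) := by
    rw [Complex.div_im]
    simp
    ring
  rw [h1]
  exact div_pos (mul_pos h τ.im_pos) (Complex.normSq_pos.2 (denom_ne_zero_of_det_pos h τ))

theorem coe_ofComplex_of_im_pos {w : ℂ} (h : 0 < w.im) : ((ofComplex w : ℍ) : ℂ) = w := by
  rw [ofComplex_apply_of_im_pos h]

theorem slash_apply (k m : ℤ) (f : ℍ → ℂ → ℂ) (M : SL(2, ℝ)) (X Y : ℝ) (τ : ℍ) (z : ℂ) :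
    slash k m f M X Y τ z = ((M 1 0 : ℂ) * τ + M 1 1) ^ (-k) *
      Complex.exp (2 * Real.pi * Complex.I * m *
        (-((M 1 0 : ℂ) * (z + X * τ + Y) ^ 2 / ((M 1 0 : ℂ) * τ + M 1 1)) +
          X ^ 2 * τ + 2 * X * z + X * Y)) *
      f (ofComplex (((M 0 0 : ℂ) * τ + M 0 1) / ((M 1 0 : ℂ) * τ + M 1 1)))
        ((z + X * τ + Y) / ((M 1 0 : ℂ) * τ + M 1 1)) := by
  have : M • τ = ofComplex (((M 0 0 : ℂ) * τ + M 0 1) / ((M 1 0 : ℂ) * τ + M 1 1)) := by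
    rw [← ofComplex_apply (M • τ), coe_specialLinearGroup_apply]
    rfl
  rw [← this]
  rfl

theorem slashInt_apply (k m : ℤ) (f : ℍ → ℂ → ℂ) (M : SL(2, ℤ)) (X Y : ℤ) (τ : ℍ) (z : ℂ) :
    slashInt k m f M X Y τ z = ((M 1 0 : ℂ) * τ + M 1 1) ^ (-k) *
      Complex.exp (2 * Real.pi * Complex.I * m *
        (-((M 1 0 : ℂ) * (z + X * τ + Y) ^ 2 / ((M 1 0 : ℂ) * τ + M 1 1)) +
          X ^ 2 * τ + 2 * X * z + X * Y)) *
      f (ofComplex (((M 0 0 : ℂ) * τ + M 0 1) / ((M 1 0 : ℂ) * τ + M 1 1)))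
        ((z + X * τ + Y) / ((M 1 0 : ℂ) * τ + M 1 1)) := by
  rw [slashInt, slash_apply]
  simp

/-- Compatibility of `f ↦ f‖A` with the Jacobi group: if `A γ = γ' A'`, then
`(f‖A)|_{k,mn}[γ,(λ,μ)] = (f|_{k,m}[γ',(λ,μ) adj A'])‖A'`. All commutation and invariance
statements about `f‖A` below are special cases. -/
theorem slashInt_heckeSlash (k m : ℤ) {n : ℕ} (f : ℍ → ℂ → ℂ)
    {A A' : Matrix (Fin 2) (Fin 2) ℤ} {γ γ' : SL(2, ℤ)} (hA' : 0 < A'.det) (hn : A'.det = n)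
    (h : A * (γ : Matrix (Fin 2) (Fin 2) ℤ) = γ' * A') (lam mu : ℤ) :
    slashInt k (m * n) (heckeSlash k m n f A) γ lam mu =
      heckeSlash k m n (slashInt k m f γ' (lam * A' 1 1 - mu * A' 1 0)
        (mu * A' 0 0 - lam * A' 0 1)) A' := by
  have hdet : A.det = n := by
    have := congrArg Matrix.det h
    simpa [Matrix.det_mul, hn] using this
  have hA : 0 < A.det := by rw [hdet, ← hn]; exact hA'
  have hγ := γ.det_coe
  have hγ' := γ'.det_coe
  rw [Matrix.det_fin_two] at hA hA' hdet hn hγ hγ'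
  have h00 := congrFun (congrFun h 0) 0
  have h01 := congrFun (congrFun h 0) 1
  have h10 := congrFun (congrFun h 1) 0
  have h11 := congrFun (congrFun h 1) 1
  simp only [Matrix.mul_apply, Fin.sum_univ_two] at h00 h01 h10 h11
  funext τ z
  rw [slashInt_apply]
  simp only [heckeSlash, slashInt_apply]
  generalize (γ : Matrix (Fin 2) (Fin 2) ℤ) 0 0 = p at *
  generalize (γ : Matrix (Fin 2) (Fin 2) ℤ) 0 1 = q at *
  generalize (γ : Matrix (Fin 2) (Fin 2) ℤ) 1 0 = r at *
  generalize (γ : Matrix (Fin 2) (Fin 2) ℤ) 1 1 = s at *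
  generalize (γ' : Matrix (Fin 2) (Fin 2) ℤ) 0 0 = p' at *
  generalize (γ' : Matrix (Fin 2) (Fin 2) ℤ) 0 1 = q' at *
  generalize (γ' : Matrix (Fin 2) (Fin 2) ℤ) 1 0 = r' at *
  generalize (γ' : Matrix (Fin 2) (Fin 2) ℤ) 1 1 = s' at *
  generalize A 0 0 = a at *
  generalize A 0 1 = b at *
  generalize A 1 0 = c at *
  generalize A 1 1 = d at *
  generalize A' 0 0 = a' at *
  generalize A' 0 1 = b' at *
  generalize A' 1 0 = c' at *
  generalize A' 1 1 = d' at *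
  have im1 : 0 < (((p : ℂ) * τ + q) / ((r : ℂ) * τ + s)).im := by
    have := im_moebius_pos (a := p) (b := q) (c := r) (d := s) (by exact_mod_cast (by omega)) τ
    simpa using this
  have im2 : 0 < (((a' : ℂ) * τ + b') / ((c' : ℂ) * τ + d')).im := by
    have := im_moebius_pos (a := a') (b := b') (c := c') (d := d') (by exact_mod_cast hA') τ
    simpa using this
  have j1 : (r : ℂ) * τ + s ≠ 0 := by
    have := denom_ne_zero_of_det_pos (a := p) (b := q) (c := r) (d := s)
      (by exact_mod_cast (by omega)) τ
    simpa using this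
  have j2 : (c' : ℂ) * τ + d' ≠ 0 := by
    have := denom_ne_zero_of_det_pos (a := a') (b := b') (c := c') (d := d')
      (by exact_mod_cast hA') τ
    simpa using this
  have j3 : (c : ℂ) * (ofComplex (((p : ℂ) * τ + q) / ((r : ℂ) * τ + s)) : ℍ) + d ≠ 0 := by
    have := denom_ne_zero_of_det_pos (a := a) (b := b) (c := c) (d := d)
      (by exact_mod_cast hA) (ofComplex (((p : ℂ) * τ + q) / ((r : ℂ) * τ + s)))
    simpa using this
  have j4 : (r' : ℂ) * (ofComplex (((a' : ℂ) * τ + b') / ((c' : ℂ) * τ + d')) : ℍ) + s' ≠ 0 := by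
    have := denom_ne_zero_of_det_pos (a := p') (b := q') (c := r') (d := s')
      (by exact_mod_cast (by omega)) (ofComplex (((a' : ℂ) * τ + b') / ((c' : ℂ) * τ + d')))
    simpa using this
  rw [coe_ofComplex_of_im_pos im1] at j3 ⊢
  rw [coe_ofComplex_of_im_pos im2] at j4 ⊢
  have C00 : (a * p + b * r : ℂ) = p' * a' + q' * c' := by exact_mod_cast h00
  have C01 : (a * q + b * s : ℂ) = p' * b' + q' * d' := by exact_mod_cast h01
  have C10 : (c * p + d * r : ℂ) = r' * a' + s' * c' := by exact_mod_cast h10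
  have C11 : (c * q + d * s : ℂ) = r' * b' + s' * d' := by exact_mod_cast h11
  have Cγ : (p * s - q * r : ℂ) = 1 := by exact_mod_cast hγ
  have Cn : (a' * d' - b' * c' : ℂ) = n := by exact_mod_cast hn
  generalize (τ : ℂ) = t at *
  clear h00 h01 h10 h11 hγ hγ' hn hA hA' hdet h im1 im2
  push_cast
  have j1c : t * (r : ℂ) + s ≠ 0 := by rwa [mul_comm]
  have j2c : t * (c' : ℂ) + d' ≠ 0 := by rwa [mul_comm]
  have e3 : (c : ℂ) * ((p * t + q) / (r * t + s)) + d =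
      ((c * p + d * r) * t + (c * q + d * s)) / (r * t + s) := by
    field_simp; ring
  have e4 : (r' : ℂ) * ((a' * t + b') / (c' * t + d')) + s' =
      ((c * p + d * r) * t + (c * q + d * s)) / (c' * t + d') := by
    rw [C10, C11]; field_simp; ring
  rw [e3] at j3 ⊢
  rw [e4] at j4 ⊢
  have e1 : (a : ℂ) * ((p * t + q) / (r * t + s)) + b =
      ((a * p + b * r) * t + (a * q + b * s)) / (r * t + s) := by
    field_simp; ring
  have e2 : (p' : ℂ) * ((a' * t + b') / (c' * t + d')) + q' =
      ((a * p + b * r) * t + (a * q + b * s)) / (c' * t + d') := by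
    rw [C00, C01]; field_simp; ring
  rw [e1, e2, div_div_div_cancel_right₀ j1, div_div_div_cancel_right₀ j2]
  -- `J` is the denominator of `A γ = γ' A'` at `τ`
  obtain ⟨J, hJ⟩ : ∃ J : ℂ, J = (c * p + d * r) * t + (c * q + d * s) := ⟨_, rfl⟩
  rw [← hJ] at j3 j4 ⊢
  have jJ : J ≠ 0 := by
    rintro rfl; simp at j3
  -- `(λ'', μ'') = (λ, μ) adj A'` satisfies `(λ'', μ'') A' = n (λ, μ)`, so both elliptic
  -- variables are `n (z + λτ + μ)` over the same denominator
  have ew : (n : ℂ) * z / (c' * t + d') + (lam * d' - mu * c') * ((a' * t + b') / (c' * t + d')) +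
      (mu * a' - lam * b') = n * (z + lam * t + mu) / (c' * t + d') := by
    rw [← Cn]; field_simp; ring
  rw [ew]
  have earg : (n : ℂ) * ((z + lam * t + mu) / (r * t + s)) / (J / (r * t + s)) =
      n * (z + lam * t + mu) / (c' * t + d') / (J / (c' * t + d')) := by
    field_simp
  rw [earg]
  have ek : ((r : ℂ) * t + s) ^ (-k) * (J / (r * t + s)) ^ (-k) =
      (c' * t + d') ^ (-k) * (J / (c' * t + d')) ^ (-k) := by
    rw [← mul_zpow, ← mul_zpow]
    congr 1
    field_simp
  -- with `N = A γ = γ' A'` and `j_M` the denominator of `M` at `τ`: cleared forms of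
  -- `c_N / j_N = c_γ / j_γ + c_A / (j_γ j_N)` and
  -- `c_N / j_N = c_{A'} / j_{A'} + n c_{γ'} / (j_{A'} j_N)`
  have c1 : (n : ℂ) * r * J + n * c = n * (c * p + d * r) * (r * t + s) := by
    rw [hJ]; linear_combination (-(n : ℂ) * c) * Cγ
  have c2 : (c' : ℂ) * J + n * r' = (c * p + d * r) * (c' * t + d') := by
    rw [hJ, C10, C11, ← Cn]; ring
  have eexp : (n : ℂ) * (-(r * (z + lam * t + mu) ^ 2 / (r * t + s)) + lam ^ 2 * t +
        2 * lam * z + lam * mu) +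
        (-(n * c * ((z + lam * t + mu) / (r * t + s)) ^ 2 / (J / (r * t + s)))) =
      (-(n * c' * z ^ 2 / (c' * t + d'))) +
        (-(r' * (n * (z + lam * t + mu) / (c' * t + d')) ^ 2 / (J / (c' * t + d'))) +
          (lam * d' - mu * c') ^ 2 * ((a' * t + b') / (c' * t + d')) +
          2 * (lam * d' - mu * c') * (n * z / (c' * t + d')) +
          (lam * d' - mu * c') * (mu * a' - lam * b')) := by
    have l1 : (n : ℂ) * (-(r * (z + lam * t + mu) ^ 2 / (r * t + s)) + lam ^ 2 * t +
        2 * lam * z + lam * mu) +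
        (-(n * c * ((z + lam * t + mu) / (r * t + s)) ^ 2 / (J / (r * t + s)))) =
        n * (lam ^ 2 * t + 2 * lam * z + lam * mu) -
          (n * (c * p + d * r)) * (z + lam * t + mu) ^ 2 / J := by
      have : (n * (c * p + d * r) : ℂ) = (n * r * J + n * c) / (r * t + s) := by
        rw [c1]; field_simp
      rw [this]
      field_simp
      ring
    have l2 : (r' : ℂ) * (n * (z + lam * t + mu) / (c' * t + d')) ^ 2 / (J / (c' * t + d')) =
        (n * (c * p + d * r)) * (z + lam * t + mu) ^ 2 / J -
          n * c' * (z + lam * t + mu) ^ 2 / (c' * t + d') := by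
      have : ((c * p + d * r) : ℂ) = (c' * J + n * r') / (c' * t + d') := by
        rw [c2]; field_simp
      rw [this]
      field_simp
      ring
    rw [l1, l2, ← Cn]
    field_simp
    ring
  have eexp' : Complex.exp (2 * Real.pi * Complex.I * (m * n) *
      (-(r * (z + lam * t + mu) ^ 2 / (r * t + s)) + lam ^ 2 * t +
        2 * lam * z + lam * mu)) * Complex.exp (2 * Real.pi * Complex.I * m *
        (-(n * c * ((z + lam * t + mu) / (r * t + s)) ^ 2 / (J / (r * t + s))))) =
      Complex.exp (2 * Real.pi * Complex.I * m * (-(n * c' * z ^ 2 / (c' * t + d')))) *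
      Complex.exp (2 * Real.pi * Complex.I * m *
        (-(r' * (n * (z + lam * t + mu) / (c' * t + d')) ^ 2 / (J / (c' * t + d'))) +
          (lam * d' - mu * c') ^ 2 * ((a' * t + b') / (c' * t + d')) +
          2 * (lam * d' - mu * c') * (n * z / (c' * t + d')) +
          (lam * d' - mu * c') * (mu * a' - lam * b'))) := by
    rw [← Complex.exp_add, ← Complex.exp_add]
    congr 1
    linear_combination (2 * Real.pi * Complex.I * m) * eexp
  generalize f _ _ = F
  linear_combination (n : ℂ) ^ (k - 1) * F * (congrArg₂ (· * ·) ek eexp')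

/-! ### Hermite normal forms -/

/-- Pairs `(a,d)` with `ad = n` together with `0 ≤ b < d`, stored as `⟨(a, d), b⟩`; they index the
terms of `V_n^∞`. -/
abbrev hermiteIndex (n : ℕ) : Finset ((_ : ℕ × ℕ) × ℕ) :=
  n.divisorsAntidiagonal.sigma fun q => Finset.range q.2

/-- The matrix `(a, b; 0, d)` of an index `⟨(a, d), b⟩`. -/
def hermiteMatrix (x : (_ : ℕ × ℕ) × ℕ) : Matrix (Fin 2) (Fin 2) ℤ :=
  !![(x.1.1 : ℤ), (x.2 : ℤ); 0, (x.1.2 : ℤ)]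

theorem mem_hermiteIndex {n : ℕ} (hn : 0 < n) {x : (_ : ℕ × ℕ) × ℕ} :
    x ∈ hermiteIndex n ↔ x.1.1 * x.1.2 = n ∧ x.2 < x.1.2 := by
  simp [hermiteIndex, hn.ne']

theorem det_hermiteMatrix {n : ℕ} (hn : 0 < n) {x : (_ : ℕ × ℕ) × ℕ} (hx : x ∈ hermiteIndex n) :
    (hermiteMatrix x).det = n := by
  rw [mem_hermiteIndex hn] at hx
  rw [hermiteMatrix, Matrix.det_fin_two_of, ← hx.1]
  simp

/-- Every integral matrix of determinant `n > 0` is `SL₂(ℤ)`-equivalent on the left to one of the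
matrices `hermiteMatrix x`. -/
theorem exists_hermite {n : ℕ} (hn : 0 < n) (A : Matrix (Fin 2) (Fin 2) ℤ) (hA : A.det = n) :
    ∃ γ : SL(2, ℤ), ∃ x ∈ hermiteIndex n, A = γ * hermiteMatrix x := by
  suffices ∀ A : FixedDetMatrix (Fin 2) ℤ (n : ℤ),
      ∃ γ : SL(2, ℤ), ∃ x ∈ hermiteIndex n, A.1 = γ * hermiteMatrix x from this ⟨A, hA⟩
  intro A
  have mul_left : ∀ (g : SL(2, ℤ)) (B : FixedDetMatrix (Fin 2) ℤ (n : ℤ)),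
      (∃ γ : SL(2, ℤ), ∃ x ∈ hermiteIndex n, B.1 = γ * hermiteMatrix x) →
      ∃ γ : SL(2, ℤ), ∃ x ∈ hermiteIndex n, (g • B).1 = γ * hermiteMatrix x := by
    rintro g B ⟨γ, x, hx, h⟩
    exact ⟨g * γ, x, hx, by
      rw [FixedDetMatrices.smul_coe, h, Matrix.SpecialLinearGroup.coe_mul, mul_assoc]⟩
  refine FixedDetMatrices.induction_on
    (C := fun A => ∃ γ : SL(2, ℤ), ∃ x ∈ hermiteIndex n, A.1 = γ * hermiteMatrix x)
    (by exact_mod_cast hn.ne') (fun A hc ha hb hd => ?_) (mul_left _) (mul_left _)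
  have hdet := A.2
  rw [Matrix.det_fin_two, hc, mul_zero, sub_zero] at hdet
  have hd0 : 0 < A.1 1 1 := by
    by_contra h
    nlinarith
  rw [abs_of_nonneg hb, abs_of_pos hd0] at hd
  refine ⟨1, ⟨((A.1 0 0).toNat, (A.1 1 1).toNat), (A.1 0 1).toNat⟩, ?_, ?_⟩
  · rw [mem_hermiteIndex hn]
    constructor
    · zify
      simp only [Int.toNat_of_nonneg ha.le, Int.toNat_of_nonneg hd0.le, hdet]
    · simp only
      omega
  · ext i j
    fin_cases i <;> fin_cases j <;> simp [hermiteMatrix, hc, ha.le, hd0.le, hb]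

theorem hermite_unique {n : ℕ} (hn : 0 < n) {x y : (_ : ℕ × ℕ) × ℕ} (hx : x ∈ hermiteIndex n)
    (hy : y ∈ hermiteIndex n) (γ : SL(2, ℤ)) (h : hermiteMatrix x = γ * hermiteMatrix y) :
    x = y := by
  obtain ⟨⟨a, d⟩, b⟩ := x
  obtain ⟨⟨a', d'⟩, b'⟩ := y
  simp only [mem_hermiteIndex hn] at hx hy
  have hγ := γ.det_coe
  rw [Matrix.det_fin_two] at hγ
  have h00 := congrFun (congrFun h 0) 0
  have h01 := congrFun (congrFun h 0) 1
  have h10 := congrFun (congrFun h 1) 0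
  have h11 := congrFun (congrFun h 1) 1
  simp only [Matrix.mul_apply, Fin.sum_univ_two, hermiteMatrix, Matrix.of_apply, Matrix.cons_val',
    Matrix.cons_val_zero, Matrix.cons_val_one, Matrix.cons_val_fin_one, mul_zero, add_zero]
    at h00 h01 h10 h11
  generalize (γ : Matrix (Fin 2) (Fin 2) ℤ) 0 0 = p at *
  generalize (γ : Matrix (Fin 2) (Fin 2) ℤ) 0 1 = q at *
  generalize (γ : Matrix (Fin 2) (Fin 2) ℤ) 1 0 = r at *
  generalize (γ : Matrix (Fin 2) (Fin 2) ℤ) 1 1 = s at *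
  have ha : 0 < a := Nat.pos_of_ne_zero (by rintro rfl; omega)
  have ha' : 0 < a' := Nat.pos_of_ne_zero (by rintro rfl; omega)
  have hr : r = 0 := by
    rcases mul_eq_zero.1 h10.symm with h | h
    · exact h
    · omega
  subst hr
  have hp : 0 < p := by
    by_contra hp
    have : p * a' ≤ 0 := mul_nonpos_of_nonpos_of_nonneg (not_lt.1 hp) (by positivity)
    omega
  have hps : p * s = 1 := by linarith
  have hp1 : p = 1 := by
    rcases Int.mul_eq_one_iff_eq_one_or_neg_one.1 hps with h | h <;> omega
  subst hp1
  have hs1 : s = 1 := by linarith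
  subst hs1
  have ea : a = a' := by omega
  have ed : d = d' := by omega
  subst ea ed
  have eb : b = b' := by
    have : (b : ℤ) % d = (b' : ℤ) % d := by
      rw [h01, one_mul, Int.add_mul_emod_self_right]
    rw [Int.emod_eq_of_lt (by omega) (by omega), Int.emod_eq_of_lt (by omega) (by omega)] at this
    omega
  subst eb
  rfl

/-- Right multiplication by `γ ∈ SL₂(ℤ)` permutes the classes `SL₂(ℤ) A` with `det A = n`. -/
theorem exists_hermite_perm {n : ℕ} (hn : 0 < n) (γ : SL(2, ℤ)) :
    ∃ (e : hermiteIndex n ≃ hermiteIndex n) (γ' : hermiteIndex n → SL(2, ℤ)),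
      ∀ x : hermiteIndex n, hermiteMatrix x * (γ : Matrix (Fin 2) (Fin 2) ℤ) =
        γ' x * hermiteMatrix (e x) := by
  have key : ∀ x : hermiteIndex n, ∃ γ' : SL(2, ℤ), ∃ y : hermiteIndex n,
      hermiteMatrix x * (γ : Matrix (Fin 2) (Fin 2) ℤ) = γ' * hermiteMatrix y := by
    intro x
    obtain ⟨γ', y, hy, h⟩ := exists_hermite hn (hermiteMatrix x * (γ : Matrix (Fin 2) (Fin 2) ℤ))
      (by rw [Matrix.det_mul, γ.det_coe, mul_one, det_hermiteMatrix hn x.2])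
    exact ⟨γ', ⟨y, hy⟩, h⟩
  choose γ' π hπ using key
  have inj : Function.Injective π := by
    intro x y hxy
    have hx := hπ x
    have hy := hπ y
    rw [← hxy] at hy
    apply Subtype.ext
    refine hermite_unique hn x.2 y.2 (γ' x * (γ' y)⁻¹) ?_
    have hy' : hermiteMatrix (π x) = ((γ' y)⁻¹ : SL(2, ℤ)) *
        (hermiteMatrix y * (γ : Matrix (Fin 2) (Fin 2) ℤ)) := by
      rw [hy, ← mul_assoc, ← Matrix.SpecialLinearGroup.coe_mul, inv_mul_cancel,
        Matrix.SpecialLinearGroup.coe_one, one_mul]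
    have hγ : (γ : Matrix (Fin 2) (Fin 2) ℤ) * (γ⁻¹ : SL(2, ℤ)) = 1 := by
      rw [← Matrix.SpecialLinearGroup.coe_mul, mul_inv_cancel, Matrix.SpecialLinearGroup.coe_one]
    calc hermiteMatrix x = hermiteMatrix x * (γ * (γ⁻¹ : SL(2, ℤ))) := by rw [hγ, mul_one]
      _ = γ' x * ((γ' y)⁻¹ : SL(2, ℤ)) * hermiteMatrix y * (γ * (γ⁻¹ : SL(2, ℤ))) := by
        rw [← mul_assoc, hx, hy']
        simp only [mul_assoc]
      _ = _ := by rw [hγ, mul_one, Matrix.SpecialLinearGroup.coe_mul]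
  exact ⟨Equiv.ofBijective π (Finite.injective_iff_bijective.1 inj), γ', hπ⟩

/-! ### The Hecke operator as a sum over Hermite normal forms -/

theorem heckeSlash_hermiteMatrix (k m : ℤ) {n : ℕ} (hn : 0 < n) (f : ℍ → ℂ → ℂ)
    {x : (_ : ℕ × ℕ) × ℕ} (hx : x ∈ hermiteIndex n) (τ : ℍ) (z : ℂ) :
    heckeSlash k m n f (hermiteMatrix x) τ z = (n : ℂ) ^ (k - 1) * (x.1.2 : ℂ) ^ (-k) *
      f (ofComplex (((x.1.1 : ℂ) * τ + x.2) / x.1.2)) (x.1.1 * z) := by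
  rw [mem_hermiteIndex hn] at hx
  have hd : (x.1.2 : ℂ) ≠ 0 := by
    have : x.1.2 ≠ 0 := by omega
    exact_mod_cast this
  have : (n : ℂ) * z / x.1.2 = x.1.1 * z := by
    rw [← hx.1]; push_cast; field_simp
  simp [heckeSlash, hermiteMatrix, this]

theorem heckeV_eq_sum (k m : ℤ) {n : ℕ} (hn : 0 < n) (f : ℍ → ℂ → ℂ) :
    heckeV k n f = ∑ x ∈ hermiteIndex n, heckeSlash k m n f (hermiteMatrix x) := by
  funext τ z
  simp only [Finset.sum_apply]
  rw [Finset.sum_congr rfl fun x hx => heckeSlash_hermiteMatrix k m hn f hx τ z,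
    Finset.sum_sigma]
  simp only [heckeV, Finset.mul_sum, mul_assoc]

theorem heckeSlash_sub (k m : ℤ) (n : ℕ) (f g : ℍ → ℂ → ℂ) (A : Matrix (Fin 2) (Fin 2) ℤ) :
    heckeSlash k m n (f - g) A = heckeSlash k m n f A - heckeSlash k m n g A := by
  funext τ z
  simp only [heckeSlash, Pi.sub_apply, mul_sub]

theorem slashInt_sum {ι : Type*} (k m : ℤ) (s : Finset ι) (F : ι → ℍ → ℂ → ℂ) (γ : SL(2, ℤ))
    (lam mu : ℤ) :
    slashInt k m (∑ i ∈ s, F i) γ lam mu = ∑ i ∈ s, slashInt k m (F i) γ lam mu := by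
  funext τ z
  simp only [slashInt, slash, Finset.sum_apply, Finset.mul_sum]

/-- The period of `V_n^∞ f` at an arbitrary element of `Γ(1)^J` is a sum of periods of `f`, each
acted on by an upper triangular matrix of determinant `n`. -/
theorem slashInt_heckeV_sub (k m : ℤ) {n : ℕ} (hn : 0 < n) (f : ℍ → ℂ → ℂ) (γ : SL(2, ℤ))
    (lam mu : ℤ) :
    ∃ (e : hermiteIndex n → SL(2, ℤ)) (u v : hermiteIndex n → ℤ),
      slashInt k (m * n) (heckeV k n f) γ lam mu - heckeV k n f =
        ∑ x : hermiteIndex n,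
          heckeSlash k m n (slashInt k m f (e x) (u x) (v x) - f) (hermiteMatrix x) := by
  obtain ⟨e, γ', h⟩ := exists_hermite_perm hn γ
  refine ⟨fun x => γ' (e.symm x), fun x => lam * hermiteMatrix x 1 1 - mu * hermiteMatrix x 1 0,
    fun x => mu * hermiteMatrix x 0 0 - lam * hermiteMatrix x 0 1, ?_⟩
  rw [heckeV_eq_sum k m hn, slashInt_sum, ← Finset.sum_coe_sort (hermiteIndex n),
    ← Finset.sum_coe_sort (hermiteIndex n) fun x => heckeSlash k m n f (hermiteMatrix x)]
  simp only [heckeSlash_sub, Finset.sum_sub_distrib]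
  congr 1
  refine (Finset.sum_congr rfl fun x _ => ?_).trans (e.sum_comp _)
  have hd := det_hermiteMatrix hn (e x).2
  rw [slashInt_heckeSlash k m f (by rw [hd]; exact_mod_cast hn) hd (h x), e.symm_apply_apply]

/-! ### Stability of the class of periods -/

/-- The growth bound in the definition of the period class never degenerates; this allows
constants, and hence changes of `ρ` and `σ`, to be absorbed into `K`. -/
theorem one_le_norm_rpow_add_im_rpow (τ : ℍ) {ρ σ : ℝ} (hρ : 0 < ρ) (hσ : 0 < σ) :
    1 ≤ ‖(τ : ℂ)‖ ^ ρ + τ.im ^ (-σ) := by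
  rcases le_total 1 ‖(τ : ℂ)‖ with h | h
  · have h1 := Real.one_le_rpow h hρ.le
    have h2 := Real.rpow_nonneg τ.im_pos.le (-σ)
    linarith
  · have him : τ.im ≤ 1 := (le_trans (le_abs_self _) (Complex.abs_im_le_norm (τ : ℂ))).trans h
    have h1 := Real.one_le_rpow_of_pos_of_le_one_of_nonpos τ.im_pos him (neg_nonpos.2 hσ.le)
    have h2 := Real.rpow_nonneg (norm_nonneg (τ : ℂ)) ρ
    linarith

theorem rpow_le_rpow_add_one {x ρ ρ' : ℝ} (hx : 0 ≤ x) (hρ : 0 < ρ) (h : ρ ≤ ρ') :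
    x ^ ρ ≤ x ^ ρ' + 1 := by
  rcases le_total 1 x with h1 | h1
  · have := Real.rpow_le_rpow_of_exponent_le h1 h
    linarith
  · have := Real.rpow_le_one hx h1 hρ.le
    have := Real.rpow_nonneg hx ρ'
    linarith

theorem norm_rpow_add_im_rpow_le (τ : ℍ) {ρ σ ρ' σ' : ℝ} (hρ : 0 < ρ) (hσ : 0 < σ)
    (hρ' : ρ ≤ ρ') (hσ' : σ ≤ σ') :
    ‖(τ : ℂ)‖ ^ ρ + τ.im ^ (-σ) ≤ 3 * (‖(τ : ℂ)‖ ^ ρ' + τ.im ^ (-σ')) := by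
  have h1 := rpow_le_rpow_add_one (norm_nonneg (τ : ℂ)) hρ hρ'
  have h2 := rpow_le_rpow_add_one (inv_nonneg.2 τ.im_pos.le) hσ hσ'
  rw [← Real.rpow_neg_eq_inv_rpow, ← Real.rpow_neg_eq_inv_rpow] at h2
  have h3 := one_le_norm_rpow_add_im_rpow τ (hρ.trans_le hρ') (hσ.trans_le hσ')
  linarith

theorem IsPeriodClass.zero (m : ℤ) : IsPeriodClass m 0 where
  holo := differentiableOn_const (0 : ℂ)
  bound := by
    refine ⟨1, 1, 1, one_pos, one_pos, one_pos, fun τ z => ?_⟩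
    have := one_le_norm_rpow_add_im_rpow τ one_pos one_pos
    simp only [Pi.zero_apply, norm_zero]
    positivity

theorem IsPeriodClass.add {m : ℤ} {g h : ℍ → ℂ → ℂ} (hg : IsPeriodClass m g)
    (hh : IsPeriodClass m h) : IsPeriodClass m (g + h) where
  holo := hg.holo.add hh.holo
  bound := by
    obtain ⟨K, ρ, σ, hK, hρ, hσ, H⟩ := hg.bound
    obtain ⟨K', ρ', σ', hK', hρ', hσ', H'⟩ := hh.bound
    refine ⟨3 * (K + K'), max ρ ρ', max σ σ', by positivity, lt_max_of_lt_left hρ,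
      lt_max_of_lt_left hσ, fun τ z => ?_⟩
    have b := norm_rpow_add_im_rpow_le τ hρ hσ (le_max_left ρ ρ') (le_max_left σ σ')
    have b' := norm_rpow_add_im_rpow_le τ hρ' hσ' (le_max_right ρ ρ') (le_max_right σ σ')
    set B := ‖(τ : ℂ)‖ ^ max ρ ρ' + τ.im ^ (-max σ σ')
    set E := Real.exp (2 * Real.pi * m * (z.im ^ 2 / τ.im))
    calc ‖(g + h) τ z‖ ≤ ‖g τ z‖ + ‖h τ z‖ := norm_add_le _ _
      _ < K * (‖(τ : ℂ)‖ ^ ρ + τ.im ^ (-σ)) * E + K' * (‖(τ : ℂ)‖ ^ ρ' + τ.im ^ (-σ')) * E :=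
        add_lt_add (H τ z) (H' τ z)
      _ ≤ K * (3 * B) * E + K' * (3 * B) * E := by gcongr
      _ = 3 * (K + K') * B * E := by ring

theorem IsPeriodClass.sum {ι : Type*} {m : ℤ} (s : Finset ι) {g : ι → ℍ → ℂ → ℂ}
    (hg : ∀ i ∈ s, IsPeriodClass m (g i)) : IsPeriodClass m (∑ i ∈ s, g i) :=
  Finset.sum_induction _ _ (fun _ _ => IsPeriodClass.add) (IsPeriodClass.zero m) hg

theorem im_hermite_div {a d : ℕ} (b : ℕ) (w : ℂ) :
    (((a : ℂ) * w + b) / d).im = a * w.im / d := by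
  rw [Complex.div_natCast_im]
  simp

theorem im_hermite_pos {n : ℕ} (hn : 0 < n) {x : (_ : ℕ × ℕ) × ℕ} (hx : x ∈ hermiteIndex n)
    {w : ℂ} (hw : 0 < w.im) : 0 < (((x.1.1 : ℂ) * w + x.2) / x.1.2).im := by
  rw [mem_hermiteIndex hn] at hx
  have ha : 0 < x.1.1 := Nat.pos_of_ne_zero fun h => by rw [h] at hx; omega
  have hd : 0 < x.1.2 := by omega
  rw [im_hermite_div]
  positivity

/-- The factor `|τ|^ρ + v^{-σ}` grows at most by a constant factor under `τ ↦ (aτ+b)/d`. -/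
theorem norm_hermite_rpow_le {n : ℕ} (hn : 0 < n) {x : (_ : ℕ × ℕ) × ℕ}
    (hx : x ∈ hermiteIndex n) (τ : ℍ) {ρ σ : ℝ} (hρ : 0 < ρ) (hσ : 0 < σ) :
    ‖((x.1.1 : ℂ) * τ + x.2) / x.1.2‖ ^ ρ + (x.1.1 * τ.im / x.1.2) ^ (-σ) ≤
      (2 * (2 * n : ℝ) ^ ρ + (n : ℝ) ^ σ) * (‖(τ : ℂ)‖ ^ ρ + τ.im ^ (-σ)) := by
  rw [mem_hermiteIndex hn] at hx
  obtain ⟨hx, hb⟩ := hx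
  have ha : 0 < x.1.1 := Nat.pos_of_ne_zero fun h => by rw [h] at hx; omega
  have hd : 0 < x.1.2 := by omega
  have hd1 : (1 : ℝ) ≤ x.1.2 := by exact_mod_cast hd
  have ha1 : (1 : ℝ) ≤ x.1.1 := by exact_mod_cast ha
  have hb1 : (x.2 : ℝ) ≤ x.1.2 := by exact_mod_cast hb.le
  have hn1 : (1 : ℝ) ≤ n := by exact_mod_cast hn
  have hadn : (x.1.1 * x.1.2 : ℝ) = n := by exact_mod_cast hx
  have han : (x.1.1 : ℝ) ≤ n := by rw [← hadn]; nlinarith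
  have hdn : (x.1.2 : ℝ) ≤ n := by rw [← hadn]; nlinarith
  have h1 := one_le_norm_rpow_add_im_rpow τ hρ hσ
  have N : ‖((x.1.1 : ℂ) * τ + x.2) / x.1.2‖ ≤ 2 * n * max ‖(τ : ℂ)‖ 1 := by
    have M1 := le_max_left ‖(τ : ℂ)‖ 1
    have M2 := le_max_right ‖(τ : ℂ)‖ 1
    rw [norm_div, Complex.norm_natCast, div_le_iff₀ (by positivity)]
    calc ‖(x.1.1 : ℂ) * τ + x.2‖ ≤ x.1.1 * ‖(τ : ℂ)‖ + x.2 := by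
          refine (norm_add_le _ _).trans ?_
          simp
      _ ≤ n * max ‖(τ : ℂ)‖ 1 + n * max ‖(τ : ℂ)‖ 1 := by
          gcongr
          nlinarith
      _ = 2 * n * max ‖(τ : ℂ)‖ 1 * 1 := by ring
      _ ≤ _ := by gcongr
  have A1 : ‖((x.1.1 : ℂ) * τ + x.2) / x.1.2‖ ^ ρ ≤ (2 * n : ℝ) ^ ρ * (‖(τ : ℂ)‖ ^ ρ + 1) := by
    refine (Real.rpow_le_rpow (norm_nonneg _) N hρ.le).trans ?_
    rw [Real.mul_rpow (by positivity) (by positivity)]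
    gcongr
    rcases le_total ‖(τ : ℂ)‖ 1 with h | h
    · rw [max_eq_right h, Real.one_rpow]
      have := Real.rpow_nonneg (norm_nonneg (τ : ℂ)) ρ
      linarith
    · rw [max_eq_left h]
      linarith
  have A2 : (x.1.1 * τ.im / x.1.2 : ℝ) ^ (-σ) ≤ (n : ℝ) ^ σ * τ.im ^ (-σ) := by
    have hv : (n : ℝ)⁻¹ * τ.im ≤ x.1.1 * τ.im / x.1.2 := by
      rw [inv_mul_eq_div]
      have := τ.im_pos
      gcongr
      nlinarith
    have hpos : 0 < (n : ℝ)⁻¹ * τ.im := mul_pos (by positivity) τ.im_pos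
    refine (Real.rpow_le_rpow_of_nonpos hpos hv (neg_nonpos.2 hσ.le)).trans ?_
    rw [Real.mul_rpow (by positivity) τ.im_pos.le, Real.inv_rpow (by positivity),
      Real.rpow_neg (by positivity) σ, inv_inv]
  have P1 : 0 ≤ (2 * n : ℝ) ^ ρ := by positivity
  have P2 : 0 ≤ (n : ℝ) ^ σ := by positivity
  have P3 : 0 ≤ ‖(τ : ℂ)‖ ^ ρ := by positivity
  have P4 : 0 ≤ τ.im ^ (-σ) := Real.rpow_nonneg τ.im_pos.le _
  nlinarith [mul_nonneg P1 P3, mul_nonneg P1 P4, mul_nonneg P2 P3]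

/-- The exponent `m y²/v`, evaluated at `((aτ+b)/d, az)` with `ad = n`, is `mn y²/v` at `(τ, z)`.
-/
theorem exponent_hermite {n : ℕ} (hn : 0 < n) {x : (_ : ℕ × ℕ) × ℕ}
    (hx : x ∈ hermiteIndex n) (m : ℤ) (τ : ℍ) (z : ℂ) :
    (m : ℝ) * (((x.1.1 : ℂ) * z).im ^ 2 / (x.1.1 * τ.im / x.1.2)) =
      ((m * n : ℤ) : ℝ) * (z.im ^ 2 / τ.im) := by
  rw [mem_hermiteIndex hn] at hx
  have ha : x.1.1 ≠ 0 := fun h => by rw [h] at hx; omega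
  have hd : x.1.2 ≠ 0 := by omega
  have hv := τ.im_pos.ne'
  rw [← hx.1]
  push_cast
  have : ((x.1.1 : ℂ) * z).im = x.1.1 * z.im := by simp
  rw [this]
  field_simp

theorem IsPeriodClass.heckeSlash {m : ℤ} {g : ℍ → ℂ → ℂ} (hg : IsPeriodClass m g) (k : ℤ)
    {n : ℕ} (hn : 0 < n) {x : (_ : ℕ × ℕ) × ℕ} (hx : x ∈ hermiteIndex n) :
    IsPeriodClass (m * n) (heckeSlash k m n g (hermiteMatrix x)) where
  holo := by
    have hmaps : Set.MapsTo
        (fun p : ℂ × ℂ => (((x.1.1 : ℂ) * p.1 + x.2) / x.1.2, (x.1.1 : ℂ) * p.2))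
        {p | 0 < p.1.im} {p | 0 < p.1.im} := fun p hp => im_hermite_pos hn hx hp
    have hcomp := (hg.holo.comp (by fun_prop) hmaps).const_mul
      ((n : ℂ) ^ (k - 1) * (x.1.2 : ℂ) ^ (-k))
    refine hcomp.congr fun p hp => ?_
    rw [heckeSlash_hermiteMatrix k m hn g hx, coe_ofComplex_of_im_pos hp]
    rfl
  bound := by
    obtain ⟨K, ρ, σ, hK, hρ, hσ, H⟩ := hg.bound
    have hx' := hx
    rw [mem_hermiteIndex hn] at hx'
    have hd : 0 < x.1.2 := by omega
    set c : ℝ := ‖(n : ℂ) ^ (k - 1) * (x.1.2 : ℂ) ^ (-k)‖ with hc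
    have hc0 : 0 < c := by
      rw [hc, norm_pos_iff]
      have h1 : (n : ℂ) ≠ 0 := by exact_mod_cast hn.ne'
      have h2 : (x.1.2 : ℂ) ≠ 0 := by exact_mod_cast hd.ne'
      exact mul_ne_zero (zpow_ne_zero _ h1) (zpow_ne_zero _ h2)
    have hC : 0 < (2 * (2 * n : ℝ) ^ ρ + (n : ℝ) ^ σ) := by positivity
    refine ⟨c * K * (2 * (2 * n : ℝ) ^ ρ + (n : ℝ) ^ σ), ρ, σ, by positivity, hρ, hσ,
      fun τ z => ?_⟩
    have him := im_hermite_pos hn hx τ.im_pos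
    rw [heckeSlash_hermiteMatrix k m hn g hx, norm_mul, ← hc]
    have Hτ := H (ofComplex (((x.1.1 : ℂ) * τ + x.2) / x.1.2)) (x.1.1 * z)
    have e2 : (ofComplex (((x.1.1 : ℂ) * τ + x.2) / x.1.2)).im = x.1.1 * τ.im / x.1.2 := by
      rw [← coe_im, coe_ofComplex_of_im_pos him, im_hermite_div]; rfl
    rw [coe_ofComplex_of_im_pos him, e2, mul_assoc _ (m : ℝ), exponent_hermite hn hx] at Hτ
    rw [mul_assoc _ ((m * n : ℤ) : ℝ)]
    calc _ < c * _ := mul_lt_mul_of_pos_left Hτ hc0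
      _ ≤ c * (K * ((2 * (2 * n : ℝ) ^ ρ + (n : ℝ) ^ σ) * (‖(τ : ℂ)‖ ^ ρ + τ.im ^ (-σ))) *
        Real.exp (2 * Real.pi * (((m * n : ℤ) : ℝ) * (z.im ^ 2 / τ.im)))) := by
          have := norm_hermite_rpow_le hn hx τ hρ hσ
          gcongr
      _ = _ := by ring

/-! ### The Hecke operator preserves Jacobi integrals -/

theorem analyticOnNhd_heckeSlash {m : ℤ} {f : ℍ → ℂ → ℂ}
    (hf : AnalyticOnNhd ℝ (fun p : ℂ × ℂ => f (ofComplex p.1) p.2) {p | 0 < p.1.im}) (k : ℤ)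
    {n : ℕ} (hn : 0 < n) {x : (_ : ℕ × ℕ) × ℕ} (hx : x ∈ hermiteIndex n) :
    AnalyticOnNhd ℝ (fun p : ℂ × ℂ => heckeSlash k m n f (hermiteMatrix x) (ofComplex p.1) p.2)
      {p | 0 < p.1.im} := by
  have hmaps : Set.MapsTo
      (fun p : ℂ × ℂ => (((x.1.1 : ℂ) * p.1 + x.2) / x.1.2, (x.1.1 : ℂ) * p.2))
      {p | 0 < p.1.im} {p | 0 < p.1.im} := fun p hp => im_hermite_pos hn hx hp
  have hopen : IsOpen {p : ℂ × ℂ | 0 < p.1.im} :=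
    isOpen_lt continuous_const (Complex.continuous_im.comp continuous_fst)
  have hg : AnalyticOnNhd ℝ
      (fun p : ℂ × ℂ => (((x.1.1 : ℂ) * p.1 + x.2) / x.1.2, (x.1.1 : ℂ) * p.2))
      {p | 0 < p.1.im} := by
    simp only [div_eq_mul_inv]
    exact (((analyticOnNhd_const.mul analyticOnNhd_fst).add analyticOnNhd_const).mul
      analyticOnNhd_const).prod (analyticOnNhd_const.mul analyticOnNhd_snd)
  have hcomp : AnalyticOnNhd ℝ (fun p : ℂ × ℂ => ((n : ℂ) ^ (k - 1) * (x.1.2 : ℂ) ^ (-k)) *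
      f (ofComplex (((x.1.1 : ℂ) * p.1 + x.2) / x.1.2)) (x.1.1 * p.2)) {p | 0 < p.1.im} :=
    analyticOnNhd_const.mul (hf.comp hg hmaps)
  refine hcomp.congr hopen fun p hp => ?_
  rw [heckeSlash_hermiteMatrix k m hn f hx, coe_ofComplex_of_im_pos hp]

theorem tendsto_heckeSlash {k m : ℤ} {f : ℍ → ℂ → ℂ}
    (hf : Tendsto (fun p : ℍ × ℂ => ‖f p.1 p.2‖ * p.1.im ^ (-(k : ℝ) / 2) *
        Real.exp (-(2 * Real.pi * m * (p.2.im ^ 2 / p.1.im))))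
      (comap (fun p : ℍ × ℂ => (p.1.im, p.2.im)) (atTop ×ˢ atTop)) (𝓝 0))
    {n : ℕ} (hn : 0 < n) {x : (_ : ℕ × ℕ) × ℕ} (hx : x ∈ hermiteIndex n) :
    Tendsto (fun p : ℍ × ℂ => ‖heckeSlash k m n f (hermiteMatrix x) p.1 p.2‖ *
        p.1.im ^ (-(k : ℝ) / 2) *
        Real.exp (-(2 * Real.pi * (m * n : ℤ) * (p.2.im ^ 2 / p.1.im))))
      (comap (fun p : ℍ × ℂ => (p.1.im, p.2.im)) (atTop ×ˢ atTop)) (𝓝 0) := by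
  have hx' := hx
  rw [mem_hermiteIndex hn] at hx'
  have hd : 0 < x.1.2 := by omega
  have ha : 0 < x.1.1 := Nat.pos_of_ne_zero fun h => by rw [h] at hx'; omega
  have hda : (0 : ℝ) < x.1.1 / x.1.2 := by positivity
  have e2 (τ : ℍ) : (ofComplex (((x.1.1 : ℂ) * τ + x.2) / x.1.2)).im =
      x.1.1 * τ.im / x.1.2 := by
    rw [← coe_im, coe_ofComplex_of_im_pos (im_hermite_pos hn hx τ.im_pos), im_hermite_div]; rfl
  have hT : Tendsto (fun p : ℍ × ℂ =>
      ((ofComplex (((x.1.1 : ℂ) * p.1 + x.2) / x.1.2) : ℍ), (x.1.1 : ℂ) * p.2))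
      (comap (fun p : ℍ × ℂ => (p.1.im, p.2.im)) (atTop ×ˢ atTop))
      (comap (fun p : ℍ × ℂ => (p.1.im, p.2.im)) (atTop ×ˢ atTop)) := by
    rw [tendsto_comap_iff]
    have h1 : Tendsto (fun v : ℝ => (x.1.1 / x.1.2 : ℝ) * v) atTop atTop :=
      tendsto_id.const_mul_atTop hda
    have h2 : Tendsto (fun y : ℝ => (x.1.1 : ℝ) * y) atTop atTop :=
      tendsto_id.const_mul_atTop (by exact_mod_cast ha)
    refine ((h1.prodMap h2).comp tendsto_comap).congr fun p => ?_
    simp only [Function.comp, Prod.map, e2]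
    congr 1
    · ring
    · simp
  have h := (hf.comp hT).const_mul
    (‖(n : ℂ) ^ (k - 1) * (x.1.2 : ℂ) ^ (-k)‖ * (x.1.1 / x.1.2 : ℝ) ^ ((k : ℝ) / 2))
  rw [mul_zero] at h
  refine h.congr fun p => ?_
  have hv : (x.1.1 * p.1.im / x.1.2 : ℝ) ^ (-(k : ℝ) / 2) =
      ((x.1.1 / x.1.2 : ℝ) ^ ((k : ℝ) / 2))⁻¹ * p.1.im ^ (-(k : ℝ) / 2) := by
    rw [mul_div_right_comm, Real.mul_rpow hda.le p.1.im_pos.le, neg_div, Real.rpow_neg hda.le]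
  have hne : (x.1.1 / x.1.2 : ℝ) ^ ((k : ℝ) / 2) ≠ 0 := (Real.rpow_pos_of_pos hda _).ne'
  simp only [Function.comp]
  rw [e2, mul_assoc _ (m : ℝ), exponent_hermite hn hx, hv,
    heckeSlash_hermiteMatrix k m hn f hx, norm_mul, mul_assoc _ ((m * n : ℤ) : ℝ)]
  field_simp
  simp only [norm_mul]

/-- The sum of a `d`-periodic function over a complete residue system does not change under a
translation. -/
theorem sum_range_add_of_periodic {M : Type*} [AddCommGroup M] {G : ℕ → M} {d : ℕ}
    (hG : ∀ b, G (b + d) = G b) (a : ℕ) :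
    ∑ b ∈ Finset.range d, G (b + a) = ∑ b ∈ Finset.range d, G b := by
  induction a with
  | zero => rfl
  | succ a ih =>
    have h := (Finset.sum_range_succ' (fun b => G (b + a)) d).symm.trans
      (Finset.sum_range_succ (fun b => G (b + a)) d)
    rw [add_comm d a, hG, zero_add, add_left_inj] at h
    rw [← ih, ← h]
    exact Finset.sum_congr rfl fun b _ => by rw [add_right_comm, add_assoc]

theorem IsJacobiIntegral.heckeV {k m : ℤ} {n : ℕ} (hn : 0 < n) {f : ℍ → ℂ → ℂ}
    (hf : IsJacobiIntegral k m f) : IsJacobiIntegral k (m * n) (heckeV k n f) where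
  analytic := by
    rw [heckeV_eq_sum k m hn]
    simp only [Finset.sum_apply]
    exact Finset.analyticOnNhd_fun_sum _ fun x hx => analyticOnNhd_heckeSlash hf.analytic k hn hx
  periodic_tau τ z := by
    simp only [JacobiHecke.heckeV]
    congr 1
    refine Finset.sum_congr rfl fun q hq => ?_
    rw [← Finset.mul_sum, ← Finset.mul_sum]
    congr 1
    obtain ⟨hq, -⟩ := Nat.mem_divisorsAntidiagonal.1 hq
    have ha : 0 < q.1 := Nat.pos_of_ne_zero fun h => by simp [h] at hq; omega
    have hd : 0 < q.2 := Nat.pos_of_ne_zero fun h => by simp [h] at hq; omega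
    have hd' : (q.2 : ℂ) ≠ 0 := by exact_mod_cast hd.ne'
    rw [← sum_range_add_of_periodic (G := fun b : ℕ =>
      f (ofComplex (((q.1 : ℂ) * τ + b) / q.2)) (q.1 * z)) (fun b => ?_) q.1]
    · refine Finset.sum_congr rfl fun b _ => ?_
      congr 3
      rw [coe_vadd]
      push_cast
      ring
    · have him : 0 < (((q.1 : ℂ) * τ + b) / q.2).im := by
        rw [im_hermite_div]
        have := τ.im_pos
        rw [coe_im]
        positivity
      refine Eq.trans ?_ (hf.periodic_tau _ _)
      congr 1
      apply UpperHalfPlane.ext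
      rw [coe_vadd, coe_ofComplex_of_im_pos him, coe_ofComplex_of_im_pos]
      · push_cast
        field_simp
        ring
      · rw [im_hermite_div]
        have := τ.im_pos
        rw [coe_im]
        positivity
  periodic_z τ z := by
    have hz : ∀ (τ : ℍ) (z : ℂ) (a : ℕ), f τ (z + a) = f τ z := by
      intro τ z a
      induction a with
      | zero => simp
      | succ a ih => rw [Nat.cast_succ, ← add_assoc, hf.periodic_z, ih]
    simp only [JacobiHecke.heckeV, mul_add, mul_one, hz]
  period γ lam mu := by
    obtain ⟨e, u, v, h⟩ := slashInt_heckeV_sub k m hn f γ lam mu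
    rw [h]
    exact IsPeriodClass.sum _ fun x _ => (hf.period _ _ _).heckeSlash k hn x.2
  growth := by
    have h := tendsto_finsetSum (hermiteIndex n) fun x hx =>
      tendsto_heckeSlash hf.growth hn hx
    rw [Finset.sum_const_zero] at h
    refine squeeze_zero (fun p => ?_) (fun p => ?_) h
    · have := p.1.im_pos
      positivity
    · rw [← Finset.sum_mul, ← Finset.sum_mul]
      have h1 : ‖JacobiHecke.heckeV k n f p.1 p.2‖ ≤
          ∑ x ∈ hermiteIndex n, ‖JacobiHecke.heckeSlash k m n f (hermiteMatrix x) p.1 p.2‖ := by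
        rw [heckeV_eq_sum k m hn]
        simp only [Finset.sum_apply]
        exact norm_sum_le _ _
      have := Real.rpow_nonneg p.1.im_pos.le (-(k : ℝ) / 2)
      gcongr

/-! ### The Euclidean shift and the sum over `𝒱̃_n` -/

section Combinatorics

/-- The matrices `(p, -q; r, s)` of determinant `n` with `r > 0`, `0 ≤ q < s` and `p > r`, where
for `q = 0` moreover `p ≥ 2r + ε`. The entries are stored as `(p, q, r, s)`. The parameter `ε ∈
{0, 1}` accounts for the half-open ranges `-d/2 < b ≤ d/2` and `-a/2 < c ≤ a/2`: the bound at the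
end point is `≤` for positive `b, c` (`ε = 0`) and `<` for negative ones (`ε = 1`). -/
noncomputable def euclidLeft (ε : ℤ) (n : ℕ) : Finset (ℤ × ℤ × ℤ × ℤ) :=
  (box n).filter fun (p, q, r, s) =>
    p * s + q * r = n ∧ 0 < r ∧ r < p ∧ 0 ≤ q ∧ q < s ∧ (q = 0 → 2 * r + ε ≤ p)

/-- The matrices `(p, -q; r, s)` of determinant `n` with `s > 0`, `0 ≤ p < r` and `q > s`, where
for `p = 0` moreover `q ≥ 2s + ε`; see `euclidLeft`. -/
noncomputable def euclidRight (ε : ℤ) (n : ℕ) : Finset (ℤ × ℤ × ℤ × ℤ) :=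
  (box n).filter fun (p, q, r, s) =>
    p * s + q * r = n ∧ 0 < s ∧ s < q ∧ 0 ≤ p ∧ p < r ∧ (p = 0 → 2 * s + ε ≤ q)

theorem mem_euclidLeft {ε : ℤ} {n : ℕ} {p q r s : ℤ} :
    (p, q, r, s) ∈ euclidLeft ε n ↔
      p * s + q * r = n ∧ 0 < r ∧ r < p ∧ 0 ≤ q ∧ q < s ∧ (q = 0 → 2 * r + ε ≤ p) := by
  simp only [euclidLeft, box, Finset.mem_filter, Finset.mem_product, Finset.mem_Icc]
  refine ⟨fun h => h.2, fun h => ⟨?_, h⟩⟩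
  obtain ⟨h, h1, h2, h3, h4, -⟩ := h
  have hq : 0 ≤ q * r := mul_nonneg h3 h1.le
  have e1 : p ≤ n := by nlinarith
  have e2 : s ≤ n := by nlinarith
  refine ⟨⟨?_, ?_⟩, ⟨?_, ?_⟩, ⟨?_, ?_⟩, ?_, ?_⟩ <;> linarith

theorem mem_euclidRight {ε : ℤ} {n : ℕ} {p q r s : ℤ} :
    (p, q, r, s) ∈ euclidRight ε n ↔
      p * s + q * r = n ∧ 0 < s ∧ s < q ∧ 0 ≤ p ∧ p < r ∧ (p = 0 → 2 * s + ε ≤ q) := by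
  simp only [euclidRight, box, Finset.mem_filter, Finset.mem_product, Finset.mem_Icc]
  refine ⟨fun h => h.2, fun h => ⟨?_, h⟩⟩
  obtain ⟨h, h1, h2, h3, h4, -⟩ := h
  have hq : 0 ≤ p * s := mul_nonneg h3 h1.le
  have e1 : q ≤ n := by nlinarith
  have e2 : r ≤ n := by nlinarith
  refine ⟨⟨?_, ?_⟩, ⟨?_, ?_⟩, ⟨?_, ?_⟩, ?_, ?_⟩ <;> linarith

variable {M : Type*} [AddCommGroup M]

/-- The condition at `p = 0` in `euclidRight` for the image of an element of `euclidLeft` with `r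
∣ p` and `t = p / r`, or the same with the two families exchanged. -/
theorem two_mul_add_le_of_mul {ε r p q s t : ℤ} (hε1 : ε ≤ 1) (hs : 0 < s)
    (hr : 0 < r) (hp : p = r * t) (hrp : r < p) (hq : 0 ≤ q) (h : q = 0 → 2 * r + ε ≤ p) :
    2 * s + ε ≤ q + s * t := by
  have ht : 2 ≤ t := by
    by_contra ht
    have : t ≤ 1 := by omega
    nlinarith
  rcases hq.eq_or_lt with rfl | hq
  · have h := h rfl
    by_cases ht2 : t = 2
    · subst ht2; nlinarith
    · have : 3 ≤ t := by omega
      nlinarith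
  · nlinarith

/-- The strict inequality `s < q` of `euclidRight` for the image of an element of `euclidLeft`,
where `t` is the integer part of `p / r`, or the same with the two families exchanged. -/
theorem lt_add_mul_of_lt {ε r p q s t : ℤ} (hε : 0 ≤ ε) (hs : 0 < s) (hr : 0 < r)
    (hp : p < r * t + r) (hrp : r < p) (hq : 0 ≤ q) (h : q = 0 → 2 * r + ε ≤ p) :
    s < q + s * t := by
  rcases hq.eq_or_lt with rfl | hq
  · have h := h rfl
    have : 2 ≤ t := by
      by_contra ht
      have : t ≤ 1 := by omega
      nlinarith
    nlinarith
  · have : 1 ≤ t := by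
      by_contra ht
      have : t ≤ 0 := by omega
      nlinarith
    nlinarith

/-- A class of matrices `(p, -q; r, s)` with `r, s > 0`, modulo adding multiples of the second row
to the first, has one member with `0 ≤ q < s` and one with `0 ≤ p < r`. Passing from one to the
other is a bijection between `euclidLeft` and `euclidRight`. -/
theorem sum_euclidLeft_eq_sum_euclidRight {ε : ℤ} (hε : 0 ≤ ε) (hε1 : ε ≤ 1) {n : ℕ}
    (Ψ : ℤ → ℤ → ℤ → ℤ → M)
    (hΨ : ∀ p q r s t : ℤ, p * s + q * r = n → Ψ (p - r * t) (q + s * t) r s = Ψ p q r s) :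
    ∑ x ∈ euclidLeft ε n, Ψ x.1 x.2.1 x.2.2.1 x.2.2.2 =
      ∑ x ∈ euclidRight ε n, Ψ x.1 x.2.1 x.2.2.1 x.2.2.2 := by
  refine Finset.sum_nbij'
    (fun x => (x.1 % x.2.2.1, x.2.1 + x.2.2.2 * (x.1 / x.2.2.1), x.2.2))
    (fun x => (x.1 + x.2.2.1 * (x.2.1 / x.2.2.2), x.2.1 % x.2.2.2, x.2.2)) ?_ ?_ ?_ ?_ ?_
  · rintro ⟨p, q, r, s⟩ hx
    rw [mem_euclidLeft] at hx
    obtain ⟨h, h1, h2, h3, h4, h5⟩ := hx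
    have hs := h3.trans_lt h4
    have e := Int.emod_add_mul_ediv p r
    have e0 := Int.emod_nonneg p h1.ne'
    have e1 := Int.emod_lt_of_pos p h1
    simp only [mem_euclidRight]
    refine ⟨by linear_combination h + s * e, hs, ?_, e0, e1, fun e2 => ?_⟩
    · exact lt_add_mul_of_lt hε hs h1 (by linarith) h2 h3 h5
    · exact two_mul_add_le_of_mul hε1 hs h1 (by linarith) h2 h3 h5
  · rintro ⟨p, q, r, s⟩ hx
    rw [mem_euclidRight] at hx
    obtain ⟨h, h1, h2, h3, h4, h5⟩ := hx
    have hr := h3.trans_lt h4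
    have e := Int.emod_add_mul_ediv q s
    have e0 := Int.emod_nonneg q h1.ne'
    have e1 := Int.emod_lt_of_pos q h1
    simp only [mem_euclidLeft]
    refine ⟨by linear_combination h + r * e, hr, ?_, e0, e1, fun e2 => ?_⟩
    · exact lt_add_mul_of_lt hε hr h1 (by linarith) h2 h3 h5
    · exact two_mul_add_le_of_mul hε1 hr h1 (by linarith) h2 h3 h5
  · rintro ⟨p, q, r, s⟩ hx
    rw [mem_euclidLeft] at hx
    obtain ⟨h, h1, h2, h3, h4, h5⟩ := hx
    have hs := h3.trans_lt h4
    simp only [Int.add_mul_ediv_left _ _ hs.ne', Int.ediv_eq_zero_of_lt h3 h4, zero_add,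
      Int.emod_add_mul_ediv, Int.add_mul_emod_self_left, Int.emod_eq_of_lt h3 h4]
  · rintro ⟨p, q, r, s⟩ hx
    rw [mem_euclidRight] at hx
    obtain ⟨h, h1, h2, h3, h4, h5⟩ := hx
    have hr := h3.trans_lt h4
    simp only [Int.add_mul_ediv_left _ _ hr.ne', Int.ediv_eq_zero_of_lt h3 h4, zero_add,
      Int.emod_add_mul_ediv, Int.add_mul_emod_self_left, Int.emod_eq_of_lt h3 h4]
  · rintro ⟨p, q, r, s⟩ hx
    rw [mem_euclidLeft] at hx
    simp only
    rw [← hΨ p q r s (p / r) hx.1, Int.emod_def]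

/-- The bijection between `euclidLeft` and `euclidRight`, with the members having a zero in the
first row split off; in both families the remaining members are parametrised by `interiorSet`. -/
theorem sum_interior_add_eq {ε : ℤ} (hε : 0 ≤ ε) (hε1 : ε ≤ 1) {n : ℕ}
    (Ψ : ℤ → ℤ → ℤ → ℤ → M)
    (hΨ : ∀ p q r s t : ℤ, p * s + q * r = n → Ψ (p - r * t) (q + s * t) r s = Ψ p q r s) :
    ∑ x ∈ interiorSet n, Ψ x.1 (-x.2.1) x.2.2.1 x.2.2.2 +
        ∑ x ∈ euclidLeft ε n with x.2.1 = 0, Ψ x.1 x.2.1 x.2.2.1 x.2.2.2 =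
      ∑ x ∈ interiorSet n, Ψ x.2.2.1 x.2.2.2 x.1 (-x.2.1) +
        ∑ x ∈ euclidRight ε n with x.1 = 0, Ψ x.1 x.2.1 x.2.2.1 x.2.2.2 := by
  have h := sum_euclidLeft_eq_sum_euclidRight hε hε1 Ψ hΨ
  rw [← Finset.sum_filter_not_add_sum_filter (euclidLeft ε n) (fun x => x.2.1 = 0),
    ← Finset.sum_filter_not_add_sum_filter (euclidRight ε n) (fun x => x.1 = 0)] at h
  have h1 : ∑ x ∈ interiorSet n, Ψ x.1 (-x.2.1) x.2.2.1 x.2.2.2 =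
      ∑ x ∈ euclidLeft ε n with ¬ x.2.1 = 0, Ψ x.1 x.2.1 x.2.2.1 x.2.2.2 := by
    refine Finset.sum_nbij' (fun x => (x.1, -x.2.1, x.2.2)) (fun x => (x.1, -x.2.1, x.2.2))
      ?_ ?_ ?_ ?_ ?_
    · rintro ⟨a, b, c, d⟩ hx
      rw [mem_interiorSet] at hx
      simp only [Finset.mem_filter, mem_euclidLeft]
      refine ⟨⟨by linarith, ?_⟩, ?_⟩ <;> omega
    · rintro ⟨p, q, r, s⟩ hx
      rw [Finset.mem_filter, mem_euclidLeft] at hx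
      simp only [mem_interiorSet] at hx ⊢
      refine ⟨by linarith, ?_⟩
      omega
    · simp
    · simp
    · simp
  have h2 : ∑ x ∈ interiorSet n, Ψ x.2.2.1 x.2.2.2 x.1 (-x.2.1) =
      ∑ x ∈ euclidRight ε n with ¬ x.1 = 0, Ψ x.1 x.2.1 x.2.2.1 x.2.2.2 := by
    refine Finset.sum_nbij' (fun x => (x.2.2.1, x.2.2.2, x.1, -x.2.1))
      (fun x => (x.2.2.1, -x.2.2.2, x.1, x.2.1)) ?_ ?_ ?_ ?_ ?_
    · rintro ⟨a, b, c, d⟩ hx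
      rw [mem_interiorSet] at hx
      simp only [Finset.mem_filter, mem_euclidRight]
      refine ⟨⟨by linarith, ?_⟩, ?_⟩ <;> omega
    · rintro ⟨p, q, r, s⟩ hx
      rw [Finset.mem_filter, mem_euclidRight] at hx
      simp only [mem_interiorSet] at hx ⊢
      refine ⟨by linarith, ?_⟩
      omega
    · simp
    · simp
    · simp
  rw [h1, h2, h]

/-- The lower triangular part of `𝒱̃_n` consists of the members of `euclidLeft 0` with `q = 0` and
of the mirror images of those of `euclidLeft 1`. -/
theorem sum_lowerSet {n : ℕ} (hn : 0 < n) (G : ℤ → ℤ → ℤ → M) :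
    ∑ x ∈ lowerSet n, G x.1 x.2.2.1 x.2.2.2 =
      ∑ x ∈ euclidLeft 0 n with x.2.1 = 0, G x.1 x.2.2.1 x.2.2.2 +
        ∑ x ∈ euclidLeft 1 n with x.2.1 = 0, G x.1 (-x.2.2.1) x.2.2.2 := by
  rw [← Finset.sum_filter_add_sum_filter_not (lowerSet n) (fun x => 0 < x.2.2.1)]
  have pos {a d : ℤ} (ha : 0 < a) (h : a * d = n) : 0 < d :=
    pos_of_mul_pos_right (by rw [h]; exact_mod_cast hn) ha.le
  congr 1
  · refine Finset.sum_nbij' id id ?_ ?_ ?_ ?_ ?_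
    · rintro ⟨a, b, c, d⟩ hx
      simp only [Finset.mem_filter, mem_lowerSet hn, mem_euclidLeft, id] at hx ⊢
      have := pos (by omega) hx.1.1
      obtain ⟨⟨h, h1, h2, h3, rfl⟩, h4⟩ := hx
      refine ⟨⟨by linarith, ?_⟩, ?_⟩ <;> omega
    · rintro ⟨a, b, c, d⟩ hx
      simp only [Finset.mem_filter, mem_lowerSet hn, mem_euclidLeft, id] at hx ⊢
      obtain ⟨⟨h, h1, h2, h3, h4⟩, rfl⟩ := hx
      refine ⟨⟨by linarith, ?_⟩, ?_⟩ <;> omega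
    · simp
    · simp
    · simp
  · refine Finset.sum_nbij' (fun x => (x.1, x.2.1, -x.2.2.1, x.2.2.2))
      (fun x => (x.1, x.2.1, -x.2.2.1, x.2.2.2)) ?_ ?_ ?_ ?_ ?_
    · rintro ⟨a, b, c, d⟩ hx
      simp only [Finset.mem_filter, mem_lowerSet hn, mem_euclidLeft] at hx ⊢
      have := pos (by omega) hx.1.1
      obtain ⟨⟨h, h1, h2, h3, rfl⟩, h4⟩ := hx
      refine ⟨⟨by linarith, ?_⟩, ?_⟩ <;> omega
    · rintro ⟨a, b, c, d⟩ hx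
      simp only [Finset.mem_filter, mem_lowerSet hn, mem_euclidLeft] at hx ⊢
      obtain ⟨⟨h, h1, h2, h3, h4⟩, rfl⟩ := hx
      refine ⟨⟨by linarith, ?_⟩, ?_⟩ <;> omega
    · simp
    · simp
    · simp

/-- The matrices of the upper triangular part of `𝒱̃_n` with `b ≠ 0` become, up to sign, after
left multiplication by `(0, -1; 1, 0)` the members of `euclidRight 0` with `p = 0` and mirror
images of those of `euclidRight 1`. -/
theorem sum_upperSet_ne {n : ℕ} (hn : 0 < n) (G : ℤ → ℤ → ℤ → M) :
    ∑ x ∈ upperSet n with ¬ x.2.1 = 0, G x.1 x.2.1 x.2.2.2 =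
      ∑ x ∈ euclidRight 0 n with x.1 = 0, G x.2.2.1 x.2.2.2 x.2.1 +
        ∑ x ∈ euclidRight 1 n with x.1 = 0, G x.2.2.1 (-x.2.2.2) x.2.1 := by
  rw [← Finset.sum_filter_add_sum_filter_not (Finset.filter _ _) (fun x => 0 < x.2.1)]
  have pos {a d : ℤ} (ha : 0 < d) (h : a * d = n) : 0 < a :=
    pos_of_mul_pos_left (by rw [h]; exact_mod_cast hn) ha.le
  congr 1
  · refine Finset.sum_nbij' (fun x => (x.2.2.1, x.2.2.2, x.1, x.2.1))
      (fun x => (x.2.2.1, x.2.2.2, x.1, x.2.1)) ?_ ?_ ?_ ?_ ?_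
    · rintro ⟨a, b, c, d⟩ hx
      simp only [Finset.mem_filter, mem_upperSet hn, mem_euclidRight] at hx ⊢
      have := pos (by omega) hx.1.1.1
      obtain ⟨⟨⟨h, h1, h2, rfl⟩, h3⟩, h4⟩ := hx
      refine ⟨⟨by linarith, ?_⟩, ?_⟩ <;> omega
    · rintro ⟨p, q, r, s⟩ hx
      simp only [Finset.mem_filter, mem_upperSet hn, mem_euclidRight] at hx ⊢
      obtain ⟨⟨h, h1, h2, h3, h4⟩, rfl⟩ := hx
      refine ⟨⟨⟨by linarith, ?_⟩, ?_⟩, ?_⟩ <;> omega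
    · simp
    · simp
    · simp
  · refine Finset.sum_nbij' (fun x => (x.2.2.1, x.2.2.2, x.1, -x.2.1))
      (fun x => (x.2.2.1, -x.2.2.2, x.1, x.2.1)) ?_ ?_ ?_ ?_ ?_
    · rintro ⟨a, b, c, d⟩ hx
      simp only [Finset.mem_filter, mem_upperSet hn, mem_euclidRight] at hx ⊢
      have := pos (by omega) hx.1.1.1
      obtain ⟨⟨⟨h, h1, h2, rfl⟩, h3⟩, h4⟩ := hx
      refine ⟨⟨by linarith, ?_⟩, ?_⟩ <;> omega
    · rintro ⟨p, q, r, s⟩ hx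
      simp only [Finset.mem_filter, mem_upperSet hn, mem_euclidRight] at hx ⊢
      obtain ⟨⟨h, h1, h2, h3, h4⟩, rfl⟩ := hx
      refine ⟨⟨⟨by linarith, ?_⟩, ?_⟩, ?_⟩ <;> omega
    · simp
    · simp
    · simp

theorem sum_hermite_eq_sum_upperSet {n : ℕ} (hn : 0 < n) (G : ℤ → ℤ → ℤ → M)
    (hG : ∀ a b d : ℤ, a * d = n → G a (b + d) d = G a b d) :
    ∑ x ∈ hermiteIndex n, G x.1.1 x.2 x.1.2 = ∑ x ∈ upperSet n, G x.1 x.2.1 x.2.2.2 := by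
  refine Finset.sum_nbij'
    (fun x => ((x.1.1 : ℤ), if 2 * x.2 ≤ x.1.2 then (x.2 : ℤ) else x.2 - x.1.2, 0, (x.1.2 : ℤ)))
    (fun x => ⟨(x.1.toNat, x.2.2.2.toNat),
      if 0 ≤ x.2.1 then x.2.1.toNat else (x.2.1 + x.2.2.2).toNat⟩) ?_ ?_ ?_ ?_ ?_
  · rintro ⟨⟨a, d⟩, b⟩ hx
    simp only [mem_hermiteIndex hn, mem_upperSet hn, and_true] at hx ⊢
    refine ⟨by exact_mod_cast hx.1, ?_⟩
    split_ifs <;> omega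
  · rintro ⟨a, b, c, d⟩ hx
    simp only [mem_hermiteIndex hn, mem_upperSet hn] at hx ⊢
    obtain ⟨h, h1, h2, rfl⟩ := hx
    have hd : 0 < d := by omega
    have ha : 0 < a := pos_of_mul_pos_left (by rw [h]; exact_mod_cast hn) hd.le
    constructor
    · zify
      rwa [Int.toNat_of_nonneg ha.le, Int.toNat_of_nonneg hd.le]
    · split_ifs <;> omega
  · rintro ⟨⟨a, d⟩, b⟩ hx
    simp only [mem_hermiteIndex hn] at hx
    simp only [Int.toNat_natCast]
    congr 1
    split_ifs <;> omega
  · rintro ⟨a, b, c, d⟩ hx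
    rw [mem_upperSet hn] at hx
    obtain ⟨h, h1, h2, rfl⟩ := hx
    have hd : 0 < d := by omega
    have ha : 0 < a := pos_of_mul_pos_left (by rw [h]; exact_mod_cast hn) hd.le
    simp only [Prod.mk.injEq, Int.toNat_of_nonneg ha.le, Int.toNat_of_nonneg hd.le, true_and,
      and_true]
    split_ifs <;> omega
  · rintro ⟨⟨a, d⟩, b⟩ hx
    simp only [mem_hermiteIndex hn] at hx
    simp only
    split_ifs
    · rfl
    · rw [← hG a (b - d) d (by exact_mod_cast hx.1), sub_add_cancel]

/-- Replacing `b` by `-b` preserves the range `-d/2 < b ≤ d/2` except at `b = d/2`, where `-b` and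
`b` agree modulo `d`. -/
theorem sum_upperSet_neg {n : ℕ} (hn : 0 < n) (G : ℤ → ℤ → ℤ → M)
    (hG : ∀ a b d : ℤ, a * d = n → G a (b + d) d = G a b d) :
    ∑ x ∈ upperSet n, G x.1 x.2.1 x.2.2.2 = ∑ x ∈ upperSet n, G x.1 (-x.2.1) x.2.2.2 := by
  have inv : ∀ x ∈ upperSet n, (fun x : ℤ × ℤ × ℤ × ℤ =>
      (x.1, if 2 * x.2.1 = x.2.2.2 then x.2.1 else -x.2.1, x.2.2)) x ∈ upperSet n := by
    rintro ⟨a, b, c, d⟩ hx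
    simp only [mem_upperSet hn] at hx ⊢
    refine ⟨hx.1, ?_⟩
    split_ifs <;> omega
  have inv' : ∀ x ∈ upperSet n, (fun x : ℤ × ℤ × ℤ × ℤ =>
      (x.1, if 2 * x.2.1 = x.2.2.2 then x.2.1 else -x.2.1, x.2.2))
      ((fun x : ℤ × ℤ × ℤ × ℤ =>
      (x.1, if 2 * x.2.1 = x.2.2.2 then x.2.1 else -x.2.1, x.2.2)) x) = x := by
    rintro ⟨a, b, c, d⟩ hx
    simp only [mem_upperSet hn, Prod.mk.injEq, and_true, true_and] at hx ⊢
    split_ifs <;> omega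
  refine Finset.sum_nbij' _ _ inv inv inv' inv' ?_
  rintro ⟨a, b, c, d⟩ hx
  simp only [mem_upperSet hn] at hx ⊢
  split_ifs with h
  · rw [← hG a (-b) d hx.1]
    congr 1
    omega
  · rw [neg_neg]

/-- Exchanging the diagonal entries takes the terms with `b ≠ 0` of `upperSet` to `lowerSet`. -/
theorem sum_upperSet_swap {n : ℕ} (hn : 0 < n) (G : ℤ → ℤ → ℤ → M) :
    ∑ x ∈ upperSet n, G x.1 x.2.1 x.2.2.2 =
      ∑ x ∈ upperSet n with x.2.1 = 0, G x.2.2.2 0 x.1 +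
        ∑ x ∈ lowerSet n, G x.2.2.2 x.2.2.1 x.1 := by
  rw [← Finset.sum_filter_add_sum_filter_not (upperSet n) (fun x => x.2.1 = 0)]
  congr 1
  · refine Finset.sum_nbij' (fun x => (x.2.2.2, x.2.1, x.2.2.1, x.1))
      (fun x => (x.2.2.2, x.2.1, x.2.2.1, x.1)) ?_ ?_ ?_ ?_ ?_
    iterate 2
      rintro ⟨a, b, c, d⟩ hx
      simp only [Finset.mem_filter, mem_upperSet hn] at hx ⊢
      obtain ⟨⟨h, h1, h2, h3⟩, rfl⟩ := hx
      have ha : 0 < a := pos_of_mul_pos_left (by rw [h]; exact_mod_cast hn) (by omega : 0 ≤ d)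
      refine ⟨⟨by linarith, ?_⟩, ?_⟩ <;> omega
    · simp
    · simp
    · rintro ⟨a, b, c, d⟩ hx
      simp only [Finset.mem_filter] at hx ⊢
      rw [hx.2]
  · refine Finset.sum_nbij' (fun x => (x.2.2.2, x.2.2.1, x.2.1, x.1))
      (fun x => (x.2.2.2, x.2.2.1, x.2.1, x.1)) ?_ ?_ ?_ ?_ ?_
    · rintro ⟨a, b, c, d⟩ hx
      simp only [Finset.mem_filter, mem_upperSet hn, mem_lowerSet hn] at hx ⊢
      obtain ⟨⟨h, h1, h2, h3⟩, h4⟩ := hx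
      refine ⟨by linarith, ?_⟩
      omega
    · rintro ⟨a, b, c, d⟩ hx
      simp only [Finset.mem_filter, mem_upperSet hn, mem_lowerSet hn] at hx ⊢
      obtain ⟨h, h1, h2, h3⟩ := hx
      refine ⟨⟨by linarith, ?_⟩, ?_⟩ <;> omega
    · simp
    · simp
    · simp

/-- With `S = (0, -1; 1, 0)`: the formal sums `T^∞ (S - 1)` and `(S - 1) 𝒱̃_n`, where `T^∞` is the
sum of all `hermiteMatrix x`, have the same image under every function `F` of the matrix that is
invariant under adding multiples of the second row to the first and under `A ↦ -A`. -/
theorem sum_hermite_mul_S_sub {n : ℕ} (hn : 0 < n) (F : ℤ → ℤ → ℤ → ℤ → M)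
    (hF : ∀ a b c d t : ℤ, a * d - b * c = n → F (a + c * t) (b + d * t) c d = F a b c d)
    (hN : ∀ a b c d : ℤ, a * d - b * c = n → F (-a) (-b) (-c) (-d) = F a b c d) :
    ∑ x ∈ hermiteIndex n, (F x.2 (-x.1.1) x.1.2 0 - F x.1.1 x.2 0 x.1.2) =
      ∑ x ∈ interiorSet n,
        ((F (-x.2.2.1) (-x.2.2.2) x.1 x.2.1 - F x.1 x.2.1 x.2.2.1 x.2.2.2) +
          (F x.2.2.1 (-x.2.2.2) x.1 (-x.2.1) - F x.1 (-x.2.1) (-x.2.2.1) x.2.2.2)) +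
      ∑ x ∈ upperSet n,
        (F (-x.2.2.1) (-x.2.2.2) x.1 x.2.1 - F x.1 x.2.1 x.2.2.1 x.2.2.2) +
      ∑ x ∈ lowerSet n,
        (F (-x.2.2.1) (-x.2.2.2) x.1 x.2.1 - F x.1 x.2.1 x.2.2.1 x.2.2.2) := by
  have hU : ∑ x ∈ upperSet n,
        (F (-x.2.2.1) (-x.2.2.2) x.1 x.2.1 - F x.1 x.2.1 x.2.2.1 x.2.2.2) =
      ∑ x ∈ upperSet n, (F 0 (-x.2.2.2) x.1 x.2.1 - F x.1 x.2.1 0 x.2.2.2) := by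
    refine Finset.sum_congr rfl ?_
    rintro ⟨a, b, c, d⟩ hx
    obtain ⟨-, -, -, rfl⟩ := (mem_upperSet hn).1 hx
    simp
  have hL : ∑ x ∈ lowerSet n,
        (F (-x.2.2.1) (-x.2.2.2) x.1 x.2.1 - F x.1 x.2.1 x.2.2.1 x.2.2.2) =
      ∑ x ∈ lowerSet n, (F (-x.2.2.1) (-x.2.2.2) x.1 0 - F x.1 0 x.2.2.1 x.2.2.2) := by
    refine Finset.sum_congr rfl ?_
    rintro ⟨a, b, c, d⟩ hx
    obtain ⟨-, -, -, -, rfl⟩ := (mem_lowerSet hn).1 hx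
    simp
  have hI : ∑ x ∈ interiorSet n, F (-x.2.2.1) (-x.2.2.2) x.1 x.2.1 =
      ∑ x ∈ interiorSet n, F x.2.2.1 x.2.2.2 (-x.1) (-x.2.1) := by
    refine Finset.sum_congr rfl ?_
    rintro ⟨a, b, c, d⟩ hx
    have h := (mem_interiorSet.1 hx).1
    rw [← hN _ _ _ _ (by linarith), neg_neg, neg_neg]
  -- residue systems modulo `d` are moved to the symmetric range `-d/2 < b ≤ d/2`
  have e1 := sum_hermite_eq_sum_upperSet hn (fun a b d => F a b 0 d) (fun a b d h => by
    have := hF a b 0 d 1 (by linarith)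
    simpa using this)
  have per : ∀ a b d : ℤ, a * d = n → F (b + d) (-a) d 0 = F b (-a) d 0 := fun a b d h => by
    have := hF b (-a) d 0 1 (by linarith)
    simpa using this
  have e2 := sum_hermite_eq_sum_upperSet hn (fun a b d => F b (-a) d 0) per
  have e3 := sum_upperSet_neg hn (fun a b d => F b (-a) d 0) per
  have e4 := sum_upperSet_swap hn (fun a b d => F (-b) (-a) d 0)
  -- the Euclidean shift for `(p, -q; r, s)` and for its mirror image `(p, q; -r, s)`, the conjugate
  -- by `diag(1, -1)`
  have e5 := sum_interior_add_eq le_rfl zero_le_one (n := n) (fun p q r s => F p (-q) r s)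
    (fun p q r s t h => by
      have := hF p (-q) r s (-t) (by linarith)
      rw [← this]
      congr 1 <;> ring)
  have e6 := sum_interior_add_eq zero_le_one le_rfl (n := n) (fun p q r s => F p q (-r) s)
    (fun p q r s t h => by
      have := hF p q (-r) s t (by linarith)
      rw [← this]
      congr 1; ring)
  have e7 := sum_lowerSet hn (fun a c d => F a 0 c d)
  have e8 := sum_upperSet_ne hn (fun a b d => F 0 (-d) a b)
  have e9 := Finset.sum_filter_add_sum_filter_not (upperSet n) (fun x => x.2.1 = 0)
    (fun x => F 0 (-x.2.2.2) x.1 x.2.1)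
  have e10 : ∑ x ∈ upperSet n with x.2.1 = 0, F 0 (-x.2.2.2) x.1 x.2.1 =
      ∑ x ∈ upperSet n with x.2.1 = 0, F (-0) (-x.2.2.2) x.1 0 := by
    refine Finset.sum_congr rfl fun x hx => ?_
    rw [(Finset.mem_filter.1 hx).2, neg_zero]
  have r5 : ∑ x ∈ euclidLeft 0 n with x.2.1 = 0, F x.1 (-x.2.1) x.2.2.1 x.2.2.2 =
      ∑ x ∈ euclidLeft 0 n with x.2.1 = 0, F x.1 0 x.2.2.1 x.2.2.2 :=
    Finset.sum_congr rfl fun x hx => by rw [(Finset.mem_filter.1 hx).2, neg_zero]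
  have r6 : ∑ x ∈ euclidLeft 1 n with x.2.1 = 0, F x.1 x.2.1 (-x.2.2.1) x.2.2.2 =
      ∑ x ∈ euclidLeft 1 n with x.2.1 = 0, F x.1 0 (-x.2.2.1) x.2.2.2 :=
    Finset.sum_congr rfl fun x hx => by rw [(Finset.mem_filter.1 hx).2]
  have s5 : ∑ x ∈ euclidRight 0 n with x.1 = 0, F x.1 (-x.2.1) x.2.2.1 x.2.2.2 =
      ∑ x ∈ euclidRight 0 n with x.1 = 0, F 0 (-x.2.1) x.2.2.1 x.2.2.2 :=
    Finset.sum_congr rfl fun x hx => by rw [(Finset.mem_filter.1 hx).2]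
  have s6 : ∑ x ∈ euclidRight 1 n with x.1 = 0, F x.1 x.2.1 (-x.2.2.1) x.2.2.2 =
      ∑ x ∈ euclidRight 1 n with x.1 = 0, F 0 (-x.2.1) x.2.2.1 (-x.2.2.2) := by
    refine Finset.sum_congr rfl ?_
    rintro ⟨p, q, r, s⟩ hx
    rw [Finset.mem_filter, mem_euclidRight] at hx
    obtain ⟨⟨h, -⟩, rfl⟩ := hx
    have := hN 0 q (-r) s (by linarith)
    simpa using this.symm
  rw [hU, hL]
  simp only [Finset.sum_sub_distrib, Finset.sum_add_distrib]
  rw [hI]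
  simp only [neg_neg] at e5 e6
  rw [r5, s5] at e5
  rw [r6, s6] at e6
  rw [e2, e1, e3, e4, ← e10, e7, ← e9, e8]
  rw [eq_sub_of_add_eq e5, eq_sub_of_add_eq e6]
  abel

end Combinatorics

/-! ### The period of `V_n^∞ f` -/

theorem slashInt_one_left {f : ℍ → ℂ → ℂ} (hz : ∀ (τ : ℍ) (z : ℂ), f τ (z + 1) = f τ z)
    (k m mu : ℤ) : slashInt k m f 1 0 mu = f := by
  funext τ z
  have h : Function.Periodic (f τ) 1 := hz τ
  have := h.int_mul mu z
  rw [mul_one] at this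
  simp [slashInt_apply, this]

theorem slashInt_one_zero (k m : ℤ) (f : ℍ → ℂ → ℂ) : slashInt k m f 1 0 0 = f := by
  funext τ z
  simp [slashInt_apply]

theorem slashInt_T_zpow {f : ℍ → ℂ → ℂ}
    (hτ : ∀ (τ : ℍ) (z : ℂ), f ((1 : ℝ) +ᵥ τ) z = f τ z) (k m t : ℤ) :
    slashInt k m f (ModularGroup.T ^ t) 0 0 = f := by
  have h : ∀ (t : ℤ) (τ : ℍ) (z : ℂ), f ((t : ℝ) +ᵥ τ) z = f τ z := by
    intro t
    induction t with
    | zero => simp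
    | succ t ih =>
      intro τ z
      rw [← ih τ z, ← hτ (((t : ℤ) : ℝ) +ᵥ τ) z, vadd_vadd]
      push_cast
      rw [add_comm]
    | pred t ih =>
      intro τ z
      rw [← ih τ z, ← hτ _ z, vadd_vadd]
      push_cast
      ring_nf
  funext τ z
  rw [slashInt_apply, ← h t τ z]
  have : ofComplex ((τ : ℂ) + t) = (t : ℝ) +ᵥ τ := by
    rw [← ofComplex_apply ((t : ℝ) +ᵥ τ), coe_vadd, add_comm]
    simp
  simp [ModularGroup.coe_T_zpow, this]

/-- The translation part of `T = [S,(1,0)]` can be moved to the left of `S`, where it becomes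
`(0,1)` and acts trivially on functions that are `1`-periodic in `z`. -/
theorem slashT_eq_slashInt_S {f : ℍ → ℂ → ℂ} (hz : ∀ (τ : ℍ) (z : ℂ), f τ (z + 1) = f τ z)
    (k m : ℤ) : slashT k m f = slashInt k m f ModularGroup.S 0 0 := by
  funext τ z
  have hτ : (τ : ℂ) ≠ 0 := ne_zero τ
  have h1 : (z + τ) / (τ : ℂ) = z / τ + 1 := by field_simp
  have h2 : -((z + τ) ^ 2 / (τ : ℂ)) + τ + 2 * z = -(z ^ 2 / τ) := by field_simp; ring
  rw [slashT, slashInt_apply, slashInt_apply]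
  simp [ModularGroup.S, h1, h2, hz]

theorem heckeSlash_mul (k m : ℤ) {n : ℕ} (hn : 0 < n) (f : ℍ → ℂ → ℂ) (γ : SL(2, ℤ))
    {A : Matrix (Fin 2) (Fin 2) ℤ} (hA : A.det = n) :
    heckeSlash k m n f (γ * A) = heckeSlash k m n (slashInt k m f γ 0 0) A := by
  have h := slashInt_heckeSlash k m f (A := γ * A) (A' := A) (γ := 1) (γ' := γ)
    (by rw [hA]; exact_mod_cast hn) hA (by simp) 0 0
  simpa [slashInt_one_zero] using h

/-- `(f‖A)|T = f‖(A S)` for `A = (a, b; 0, d)`: the translation part of `T` becomes `(0, a)`. -/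
theorem slashT_heckeSlash_hermiteMatrix {f : ℍ → ℂ → ℂ}
    (hz : ∀ (τ : ℍ) (z : ℂ), f τ (z + 1) = f τ z) (k m : ℤ) {n : ℕ} (hn : 0 < n)
    {x : (_ : ℕ × ℕ) × ℕ} (hx : x ∈ hermiteIndex n) :
    slashT k (m * n) (heckeSlash k m n f (hermiteMatrix x)) =
      heckeSlash k m n f !![(x.2 : ℤ), -(x.1.1 : ℤ); (x.1.2 : ℤ), 0] := by
  have hdet : (!![(x.2 : ℤ), -(x.1.1 : ℤ); (x.1.2 : ℤ), 0]).det = n := by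
    rw [mem_hermiteIndex hn] at hx
    rw [Matrix.det_fin_two_of, ← hx.1]
    push_cast; ring
  rw [slashT, slashInt_heckeSlash k m f (A' := !![(x.2 : ℤ), -(x.1.1 : ℤ); (x.1.2 : ℤ), 0])
    (γ' := 1) (by rw [hdet]; exact_mod_cast hn) hdet]
  · simp [slashInt_one_left hz]
  · simp [hermiteMatrix, ModularGroup.S]

/-- The normalisation in the statement: `n^{k/2-1}` times the slash of `P(τ, √n z)` by `A` is
`P‖A`. -/
theorem slashMat_scale (k m : ℤ) {n : ℕ} (hn : 0 < n) (g : ℍ → ℂ → ℂ) {a b c d : ℤ}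
    (h : a * d - b * c = n) :
    ((((n : ℝ) ^ ((k : ℝ) / 2 - 1) : ℝ)) : ℂ) • slashMat k (m * n) (scale n g) a b c d =
      heckeSlash k m n g !![a, b; c, d] := by
  have hn' : (0 : ℝ) < n := by exact_mod_cast hn
  have hR : (a * d - b * c : ℝ) = n := by exact_mod_cast h
  have hdet : (!![(a : ℝ), b; c, d]).det = n := by rw [Matrix.det_fin_two_of, hR]
  have hs : (Real.sqrt n : ℂ) ≠ 0 := by
    exact_mod_cast (Real.sqrt_pos.2 hn').ne'
  have hss : (Real.sqrt n : ℂ) * Real.sqrt n = n := by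
    exact_mod_cast Real.mul_self_sqrt hn'.le
  have hconst : (((n : ℝ) ^ ((k : ℝ) / 2 - 1) : ℝ) : ℂ) * (Real.sqrt n : ℂ) ^ k =
      (n : ℂ) ^ (k - 1) := by
    have : (n : ℝ) ^ ((k : ℝ) / 2 - 1) * Real.sqrt n ^ k = (n : ℝ) ^ (k - 1) := by
      rw [Real.sqrt_eq_rpow, ← Real.rpow_intCast, ← Real.rpow_intCast, ← Real.rpow_mul hn'.le,
        ← Real.rpow_add hn']
      congr 1
      push_cast
      ring
    rw [← Complex.ofReal_zpow, ← Complex.ofReal_mul, this, Complex.ofReal_zpow,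
      Complex.ofReal_natCast]
  funext τ z
  have hj : (c : ℂ) * τ + d ≠ 0 := by
    have := denom_ne_zero_of_det_pos (a := a) (b := b) (c := c) (d := d)
      (by rw [hR]; exact hn') τ
    simpa using this
  have e0 : ((Real.sqrt n : ℂ)⁻¹ * c) * τ + (Real.sqrt n : ℂ)⁻¹ * d =
      (Real.sqrt n : ℂ)⁻¹ * (c * τ + d) := by ring
  have e1 : ((Real.sqrt n : ℂ)⁻¹ * a) * τ + (Real.sqrt n : ℂ)⁻¹ * b =
      (Real.sqrt n : ℂ)⁻¹ * (a * τ + b) := by ring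
  have e2 : (Real.sqrt n : ℂ) * (z / ((Real.sqrt n : ℂ)⁻¹ * (c * τ + d))) =
      n * z / (c * τ + d) := by
    rw [← hss]; field_simp
  have e3 : (2 * Real.pi * Complex.I * (m * n) *
      (-((Real.sqrt n : ℂ)⁻¹ * c * z ^ 2 / ((Real.sqrt n : ℂ)⁻¹ * (c * τ + d)))) : ℂ) =
      2 * Real.pi * Complex.I * m * (-(n * c * z ^ 2 / (c * τ + d))) := by
    rw [mul_assoc (Real.sqrt n : ℂ)⁻¹, mul_div_mul_left _ _ (inv_ne_zero hs)]
    ring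
  have e4 : ((Real.sqrt n : ℂ)⁻¹ * (c * τ + d)) ^ (-k) =
      (Real.sqrt n : ℂ) ^ k * (c * τ + d) ^ (-k) := by
    rw [mul_zpow, inv_zpow', neg_neg]
  have hpos : 0 < (!![(a : ℝ), b; c, d]).det := by rw [hdet]; exact hn'
  simp only [Pi.smul_apply, smul_eq_mul]
  rw [slashMat, slashPos, dif_pos hpos, slash_apply]
  simp only [normalize, hdet, scale, heckeSlash]
  simp only [Matrix.smul_apply, Matrix.of_apply, Matrix.cons_val', Matrix.cons_val_zero,
    Matrix.cons_val_one, Matrix.cons_val_fin_one, smul_eq_mul, Complex.ofReal_mul,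
    Complex.ofReal_inv, Complex.ofReal_intCast, Complex.ofReal_zero, zero_mul, add_zero,
    mul_zero, ne_eq, OfNat.ofNat_ne_zero, not_false_eq_true, zero_pow, Int.cast_mul,
    Int.cast_natCast]
  rw [e0, e1, e2, e3, e4, mul_div_mul_left _ _ (inv_ne_zero hs), ← hconst]
  ring

/-- The period of `V_n^∞ f` at `T` in terms of that of `f`. -/
theorem heckeV_period_eq_slashVtilde {k m : ℤ} {n : ℕ} (hn : 0 < n) {f : ℍ → ℂ → ℂ}
    (hτ : ∀ (τ : ℍ) (z : ℂ), f ((1 : ℝ) +ᵥ τ) z = f τ z)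
    (hz : ∀ (τ : ℍ) (z : ℂ), f τ (z + 1) = f τ z) (hneg : slashInt k m f (-1) 0 0 = f) :
    slashT k (m * n) (heckeV k n f) - heckeV k n f =
      ((((n : ℝ) ^ ((k : ℝ) / 2 - 1) : ℝ)) : ℂ) •
        slashVtilde k (m * n) n (scale n (slashT k m f - f)) := by
  have hP : slashT k m f - f = slashInt k m f ModularGroup.S 0 0 - f := by
    rw [slashT_eq_slashInt_S hz]
  set P := slashT k m f - f
  have hPhat : slashT k (m * n) (heckeV k n f) - heckeV k n f = ∑ x ∈ hermiteIndex n,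
      (heckeSlash k m n f !![(x.2 : ℤ), -(x.1.1 : ℤ); (x.1.2 : ℤ), 0] -
        heckeSlash k m n f !![(x.1.1 : ℤ), (x.2 : ℤ); 0, (x.1.2 : ℤ)]) := by
    rw [heckeV_eq_sum k m hn, slashT, slashInt_sum,
      Finset.sum_sub_distrib]
    congr 1
    exact Finset.sum_congr rfl fun x hx => slashT_heckeSlash_hermiteMatrix hz k m hn hx
  -- for `P = f|S - f` one has `P‖A = f‖(S A) - f‖A`
  have hPA : ∀ a b c d : ℤ, a * d - b * c = n →
      heckeSlash k m n f !![-c, -d; a, b] - heckeSlash k m n f !![a, b; c, d] =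
        ((((n : ℝ) ^ ((k : ℝ) / 2 - 1) : ℝ)) : ℂ) • slashMat k (m * n) (scale n P) a b c d := by
    intro a b c d h
    have hdet : (!![a, b; c, d]).det = n := by rw [Matrix.det_fin_two_of, h]
    rw [slashMat_scale k m hn P h, hP, heckeSlash_sub, ← heckeSlash_mul k m hn f _ hdet]
    simp [ModularGroup.S]
  rw [hPhat, sum_hermite_mul_S_sub hn (fun a b c d => heckeSlash k m n f !![a, b; c, d]),
    slashVtilde, smul_add, smul_add, Finset.smul_sum, Finset.smul_sum, Finset.smul_sum]
  · congr 1
    · congr 1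
      · refine Finset.sum_congr rfl ?_
        rintro ⟨a, b, c, d⟩ hx
        have h := (mem_interiorSet.1 hx).1
        have h' := hPA a (-b) (-c) d (by linarith)
        rw [neg_neg] at h'
        rw [smul_add, ← hPA _ _ _ _ h, ← h']
      · refine Finset.sum_congr rfl ?_
        rintro ⟨a, b, c, d⟩ hx
        obtain ⟨h, -, -, rfl⟩ := (mem_upperSet hn).1 hx
        exact hPA _ _ _ _ (by linarith)
    · refine Finset.sum_congr rfl ?_
      rintro ⟨a, b, c, d⟩ hx
      obtain ⟨h, -, -, -, rfl⟩ := (mem_lowerSet hn).1 hx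
      exact hPA _ _ _ _ (by linarith)
  · intro a b c d t h
    have hdet : (!![a, b; c, d]).det = n := by rw [Matrix.det_fin_two_of, h]
    have := heckeSlash_mul k m hn f (ModularGroup.T ^ t) hdet
    rw [slashInt_T_zpow hτ, ModularGroup.coe_T_zpow] at this
    rw [← this]
    simp [mul_comm]
  · intro a b c d h
    have hdet : (!![a, b; c, d]).det = n := by rw [Matrix.det_fin_two_of, h]
    have := heckeSlash_mul k m hn f (-1) hdet
    rw [hneg] at this
    rw [← this]
    simp

end JacobiHecke

theorem theorem2p1 (k m : ℤ) (n : ℕ) (hn : 0 < n) (f : ℍ → ℂ → ℂ)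
    (hf : JacobiHecke.IsJacobiIntegral k m f) :
    JacobiHecke.IsJacobiIntegral k (m * n) (JacobiHecke.heckeV k n f) ∧
    (JacobiHecke.slashInt k m f (-1) 0 0 = f →
      ∀ P Phat : ℍ → ℂ → ℂ,
        JacobiHecke.slashT k m f = f + P →
        JacobiHecke.slashT k (m * n) (JacobiHecke.heckeV k n f) =
          JacobiHecke.heckeV k n f + Phat →
        Phat = ((((n : ℝ) ^ ((k : ℝ) / 2 - 1) : ℝ)) : ℂ) •
          JacobiHecke.slashVtilde k (m * n) n (JacobiHecke.scale n P)) := by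
  refine ⟨hf.heckeV hn, fun hneg P Phat hP hPhat => ?_⟩
  rw [eq_sub_of_add_eq' hP.symm, eq_sub_of_add_eq' hPhat.symm]
  exact JacobiHecke.heckeV_period_eq_slashVtilde hn hf.periodic_tau hf.periodic_z hneg
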